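/- Let $K$ be a commutative locally compact hypergroup (in the sense of Dunkl, Jewett and Spector), with convolution $(x,y)\mapsto\omega(x,y)$, where $\omega(x,y)=\delta_x*\delta_y$ is a Radon probability measure with compact support, involution $x\mapsto\tilde x$ and identity $e$. For $A,B\subseteq K$ put $A\cdot B=\bigcup_{a\in A,\,b\in B}\operatorname{supp}\omega(a,b)$. A subhypergroup of $K$ is a nonempty closed set $H\subseteq K$ with $H\cdot H=H$ and $\tilde H=H$; it is called a subgroup if $\omega(x,y)$ is a point measure for all $x,y\in H$. Let $H$ be a subgroup or a compact subhypergroup of $K$, let $K/H=\{xH:x\in K\}$, $xH=\{x\}\cdot H$, carry the quotient topology, let $p:K\to K/H$, $p(x)=xH$, be the canonical projection, and equip $K/H$ with the hypergroup structure $\omega(xH,yH)=\int_K\delta_{zH}\,d\omega(x,y)(z)$, $(xH)^{\sim}=\tilde xH$. For a commutative hypergroup $L$ let $\widehat L$ be the set of all nonzero bounded continuous $\alpha:L\to\mathbb C$ with $\int\alpha\,d\omega(x,y)=\alpha(x)\alpha(y)$ and $\alpha(\tilde x)=\overline{\alpha(x)}$ for all $x,y\in L$, and put $T_xf(y)=\int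 f\,d\omega(x,y)$. Let $L^\infty(L)$ be formed with respect to a Haar measure of $L$, that is, a nonzero Radon measure $m$ with $\int T_xf\,dm=\int f\,dm$ for all $x\in L$ and $f\in C_c(L)$. For $\alpha\in\widehat L$, the hypergroup $L$ is called $\alpha$-amenable if there is a bounded linear functional $m_\alpha$ on $L^\infty(L)$ with $m_\alpha(\alpha)=1$ and $m_\alpha(T_xf)=\alpha(x)\,m_\alpha(f)$ for all $f\in L^\infty(L)$ and $x\in L$. Then for every $\gamma\in\widehat{K/H}$ the function $\gamma\circ p$ belongs to $\widehat K$, and $K/H$ is $\gamma$-amenable if and only if $K$ is $(\gamma\circ p)$-amenable. -/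

import Mathlib

open MeasureTheory
open scoped BoundedContinuousFunction

noncomputable section

/-- The data of a convolution on a Borel space: the measures `conv x y = δ_x * δ_y`
(written `ω(x, y)`), an involution and a distinguished point. No law is imposed here. -/
structure ConvData (K : Type*) [MeasurableSpace K] where
  conv : K → K → Measure K
  inv : K → K
  one : K

/-- The axioms of a commutative hypergroup (in the sense of Dunkl, Jewett and Spector) on a
locally compact Hausdorff space `K`. -/
structure IsCommHypergroup {K : Type*} [TopologicalSpace K] [T2Space K] [LocallyCompactSpace K]
    [MeasurableSpace K] [BorelSpace K] (S : ConvData K) : Prop where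
  /-- each `ω(x, y)` is a Radon probability measure with compact support -/
  isProbability : ∀ x y, IsProbabilityMeasure (S.conv x y)
  regular : ∀ x y, (S.conv x y).Regular
  isCompact_support : ∀ x y, IsCompact (S.conv x y).support
  /-- `(x, y) ↦ ω(x, y)` is continuous for the weak topology on probability measures -/
  continuous_conv : ∀ f : K →ᵇ ℝ, Continuous fun q : K × K => ∫ t, f t ∂S.conv q.1 q.2
  /-- `(x, y) ↦ supp ω(x, y)` is continuous for the Michael (Vietoris) topology -/
  continuous_support : @Continuous (K × K) (Set K) _ (TopologicalSpace.vietoris K)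
    fun q => (S.conv q.1 q.2).support
  /-- `(δ_x * δ_y) * δ_z = δ_x * (δ_y * δ_z)` -/
  assoc : ∀ (f : K →ᵇ ℝ) (x y z : K),
    ∫ u, (∫ t, f t ∂S.conv u z) ∂S.conv x y = ∫ u, (∫ t, f t ∂S.conv x u) ∂S.conv y z
  one_conv : ∀ x, S.conv S.one x = Measure.dirac x
  comm : ∀ x y, S.conv x y = S.conv y x
  continuous_inv : Continuous S.inv
  inv_inv : ∀ x, S.inv (S.inv x) = x
  map_inv : ∀ x y, (S.conv x y).map S.inv = S.conv (S.inv y) (S.inv x)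
  one_mem_support : ∀ x y, S.one ∈ (S.conv x y).support ↔ x = S.inv y

namespace ConvData

section Basic

variable {K : Type*} [TopologicalSpace K] [MeasurableSpace K] (S : ConvData K)

/-- The product `A · B = ⋃_{a ∈ A, b ∈ B} supp ω(a, b)` of two subsets. -/
def setMul (A B : Set K) : Set K := ⋃ a ∈ A, ⋃ b ∈ B, (S.conv a b).support

/-- Subhypergroups: nonempty closed sets `H` with `H · H = H` and `H~ = H`. -/
structure IsSubhypergroup (H : Set K) : Prop where
  nonempty : H.Nonempty
  isClosed : IsClosed H
  mul_eq : S.setMul H H = H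
  inv_eq : S.inv '' H = H

/-- Subgroups: subhypergroups on which the convolution of two points is a point. -/
structure IsSubgroup (H : Set K) : Prop extends S.IsSubhypergroup H where
  conv_eq_dirac : ∀ x ∈ H, ∀ y ∈ H, ∃ z ∈ H, S.conv x y = Measure.dirac z

/-- The translate `T_x f (y) = ∫ f dω(x, y)`. -/
def translate (x : K) (f : K → ℂ) (y : K) : ℂ := ∫ t, f t ∂S.conv x y

/-- The characters in `K^`: nonzero bounded continuous functions `α` with
`∫ α dω(x, y) = α(x) α(y)` and `α(x~) = conj α(x)`. -/
structure IsCharacter (α : K →ᵇ ℂ) : Prop where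
  ne_zero : α ≠ 0
  map_conv : ∀ x y, ∫ t, α t ∂S.conv x y = α x * α y
  map_inv : ∀ x, α (S.inv x) = starRingEnd ℂ (α x)

/-- Haar measures: nonzero Radon measures `m` with `∫ T_x f dm = ∫ f dm` for all `x` and all
`f ∈ C_c(K)`. The Radon measure is taken inner regular on all Borel sets, so that locally null
sets are null and `L^∞(K, m)` is the usual space also if `m` is not `σ`-finite. -/
structure IsHaar (m : Measure K) : Prop where
  ne_zero : m ≠ 0
  finiteOnCompacts : IsFiniteMeasureOnCompacts m
  innerRegular : m.InnerRegular
  integral_translate : ∀ (x : K) (f : K → ℂ), Continuous f → HasCompactSupport f →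
    ∫ y, S.translate x f y ∂m = ∫ y, f y ∂m

end Basic

end ConvData

theorem memLp_top_of_bcf {K : Type*} [TopologicalSpace K] [MeasurableSpace K] [BorelSpace K]
    (m : Measure K) (α : K →ᵇ ℂ) : MemLp α ⊤ m :=
  memLp_top_of_bound α.continuous.aestronglyMeasurable ‖α‖
    (Filter.Eventually.of_forall fun x => α.norm_coe_le_norm x)

namespace ConvData

/-- `α`-amenability, i.e. `α`-amenability of `L^∞(K) = L^∞(K, m)`: there is a bounded linear
functional `M` on `L^∞(K)` with `M(α) = 1` and `M(T_x f) = α(x) M(f)` for all `f ∈ L^∞(K)`,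
`x ∈ K`. Here `g` runs over the (unique) class in `L^∞(K)` that is represented by `T_x f`. -/
def IsAmenable {K : Type*} [TopologicalSpace K] [MeasurableSpace K] [BorelSpace K]
    (S : ConvData K) (m : Measure K) (α : K →ᵇ ℂ) : Prop :=
  ∃ M : Lp ℂ ⊤ m →L[ℂ] ℂ,
    M ((memLp_top_of_bcf m α).toLp α) = 1 ∧
    ∀ (x : K) (f g : Lp ℂ ⊤ m), g =ᵐ[m] S.translate x f → M g = α x * M f

section Quotient

variable {K : Type*} [TopologicalSpace K] [MeasurableSpace K] (S : ConvData K) (H : Set K)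

/-- The coset `xH = {x} · H`. -/
def coset (x : K) : Set K := S.setMul {x} H

/-- The space `K/H = {xH : x ∈ K}` of cosets: two points are identified if their cosets
agree. -/
def QuotSpace : Type _ := Quotient (Setoid.ker (S.coset H))

/-- The canonical projection `p : K → K/H`, `x ↦ xH`. -/
def proj (x : K) : S.QuotSpace H := Quotient.mk (Setoid.ker (S.coset H)) x

/-- The quotient topology. -/
instance : TopologicalSpace (S.QuotSpace H) :=
  inferInstanceAs (TopologicalSpace (Quotient (Setoid.ker (S.coset H))))

/-- `K/H` carries the Borel sets of the quotient topology. -/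
instance : MeasurableSpace (S.QuotSpace H) := _root_.borel _

instance : BorelSpace (S.QuotSpace H) := ⟨rfl⟩

theorem continuous_proj : Continuous (S.proj H) := continuous_quotient_mk'

/-- A point of the coset `a`. -/
def rep (a : S.QuotSpace H) : K := Quotient.out a

theorem proj_rep (a : S.QuotSpace H) : S.proj H (S.rep H a) = a := Quotient.out_eq a

/-- The convolution `ω(xH, yH) = ∫ δ_{zH} dω(x, y)(z)`, i.e. the image of `ω(x, y)` under `p`,
with the involution `(xH)~ = x~H` and the identity `eH`. They are computed at representatives of
the cosets; for a subgroup or a compact subhypergroup `H` of a commutative hypergroup they do not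
depend on the choice of these. -/
def quot : ConvData (S.QuotSpace H) where
  conv a b := (S.conv (S.rep H a) (S.rep H b)).map (S.proj H)
  inv a := S.proj H (S.inv (S.rep H a))
  one := S.proj H S.one

/-- The function `γ ∘ p` on `K`, for `γ ∈ C^b(K/H)`. -/
def pullback (γ : S.QuotSpace H →ᵇ ℂ) : K →ᵇ ℂ :=
  γ.compContinuous ⟨S.proj H, S.continuous_proj H⟩

end Quotient

end ConvData

end

noncomputable section

open Set Filter Topology

/-! ### Integrals against regular measures, read off on the support. -/

section SupportIntegrals

variable {X : Type*} [TopologicalSpace X] [MeasurableSpace X] {μ : Measure X}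

/-! Write `α = γ ∘ p`; since `p` sends `H` to the identity coset, `α = 1` on `H`. From `K` to `K/H`,
a functional on `L^∞(K)` is composed with `f ↦ f ∘ p`. On classes this makes sense only if `p` pulls
null sets back to null sets (`measure_preimage_proj_eq_zero`). No Weil formula is used: a double
integral over `K × K/H`, estimated from both sides, shows that the image of a compact set of
positive measure cannot be null.

From `K/H` to `K`, an `L^∞` function has to be averaged over `H`, which may be noncompact. It is
first smoothed to `Φf(x) = ∫ f · T_{x~} v dm` for a bump `v` with `c = ∫ v α dm ≠ 0` (`smear`). Then
`Φ` commutes with translations, `Φα = c α`, and `x ↦ T_x Φf` is norm continuous into the bounded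
continuous functions. There the `T_h`, `h ∈ H`, are commuting contractions fixing `α`, so a Cesàro
and Hahn–Banach argument gives a functional `μ`, invariant under them, with `μ(α) = 1`
(`exists_invariant_functional`). The function `x ↦ μ(T_x Φf)` is `H`-invariant, hence descends to a
bounded continuous `Df` on `K/H`; moreover `Dα = c γ` and `D(T_z f) = T_{zH} Df`. The required
functional is `c⁻¹ m_γ ∘ D`.

The alternative "subgroup or compact" is essential in one place only: an `H`-invariant continuous
function is constant on cosets (`eq_of_proj_eq_of_avg_eq`). This also makes the convolution of `K/H`
well defined (`isCommHypergroup_quot`).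

The analytic groundwork is that `T_{x~}` is the adjoint of `T_x`: on `C_c` by approximate kernels
(`integral_avg_mul`), then for bounded measurable functions by an identity of Borel measures that
needs no σ-finiteness (`bind_conv_eq`, `integral_smul_avg`). -/

theorem integral_eq_of_eqOn_support {E : Type*} [NormedAddCommGroup E] [NormedSpace ℝ E]
    [CompleteSpace E] [μ.Regular]
    [IsProbabilityMeasure μ] {f : X → E} {c : E} (h : ∀ t ∈ μ.support, f t = c) :
    ∫ t, f t ∂μ = c := by
  have : f =ᵐ[μ] fun _ => c := by
    filter_upwards [Measure.support_mem_ae_of_regular (μ := μ)] with t ht using h t ht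
  rw [integral_congr_ae this]
  simp

theorem integral_congr_support {E : Type*} [NormedAddCommGroup E] [NormedSpace ℝ E] [μ.Regular]
    {f g : X → E} (h : ∀ t ∈ μ.support, f t = g t) :
    ∫ t, f t ∂μ = ∫ t, g t ∂μ :=
  integral_congr_ae (by
    filter_upwards [Measure.support_mem_ae_of_regular (μ := μ)] with t ht using h t ht)

theorem integral_pos_of_mem_support [OpensMeasurableSpace X] [IsFiniteMeasure μ] (f : X →ᵇ ℝ) (hf : ∀ t, 0 ≤ f t)
    {t : X} (ht : t ∈ μ.support) (hft : 0 < f t) : 0 < ∫ t, f t ∂μ := by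
  rw [integral_pos_iff_support_of_nonneg hf (f.integrable μ)]
  refine (Measure.mem_support_iff_forall t).1 ht _ ?_
  exact (f.continuous.isOpen_support).mem_nhds hft.ne'

theorem exists_mem_support_ne_zero [μ.Regular] {f : X → ℝ} (h : ∫ t, f t ∂μ ≠ 0) :
    ∃ t ∈ μ.support, f t ≠ 0 := by
  by_contra! hc
  exact h (by rw [integral_congr_support (g := fun _ => 0) hc]; simp)

theorem integrable_of_isCompact_support {E : Type*} [NormedAddCommGroup E] [T2Space X]
    [OpensMeasurableSpace X] [IsFiniteMeasure μ] [μ.Regular] (hμ : IsCompact μ.support)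
    {f : X → E} (hf : Continuous f) : Integrable f μ := by
  have h : IntegrableOn f μ.support μ := hf.continuousOn.integrableOn_compact hμ
  have hs : ∀ᵐ x ∂μ, x ∈ μ.support := Measure.support_mem_ae_of_regular
  rwa [IntegrableOn, Measure.restrict_eq_self_of_ae_mem hs] at h

end SupportIntegrals

/-- A continuous bump function: `1` on a compact set, `0` off a neighbourhood of it, with compact
support and values in `[0, 1]`. -/
theorem exists_bump {X : Type*} [TopologicalSpace X] [T2Space X] [LocallyCompactSpace X]
    {C U : Set X} (hC : IsCompact C) (hU : IsOpen U) (hCU : C ⊆ U) :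
    ∃ f : X →ᵇ ℝ, HasCompactSupport f ∧ (∀ x ∈ C, f x = 1) ∧ (∀ x, 0 ≤ f x) ∧ (∀ x, f x ≤ 1) ∧
      tsupport f ⊆ U := by
  obtain ⟨V, hVo, hCV, hVU, hVc⟩ := exists_open_between_and_isCompact_closure hC hU hCU
  obtain ⟨f, hf1, hf0, hfc, hf⟩ := exists_continuous_one_zero_of_isCompact hC
    hVo.isClosed_compl (disjoint_compl_right_iff_subset.2 hCV)
  refine ⟨BoundedContinuousFunction.mkOfBound f 1 fun x y => ?_, hfc, fun x hx => hf1 hx,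
    fun x => (hf x).1, fun x => (hf x).2, ?_⟩
  · rw [Real.dist_eq, abs_le]
    have := hf x; have := hf y
    constructor <;> linarith [(hf x).1, (hf x).2, (hf y).1, (hf y).2]
  · refine (closure_mono fun x hx => ?_ : tsupport f ⊆ closure V).trans hVU
    by_contra h
    exact hx (hf0 h)

/-- A bounded continuous function from a continuous function with compact support. -/
def bcfOfCompactSupport {X : Type*} [TopologicalSpace X] {E : Type*} [NormedAddCommGroup E]
    (f : X → E) (hf : Continuous f) (hc : HasCompactSupport f) : X →ᵇ E :=
  BoundedContinuousFunction.ofNormedAddCommGroup f hf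
    (hf.bounded_above_of_compact_support hc).choose
    (hf.bounded_above_of_compact_support hc).choose_spec

/-! ### Calculus of supports in a commutative hypergroup. -/

namespace IsCommHypergroup

variable {K : Type*} [TopologicalSpace K] [T2Space K] [LocallyCompactSpace K]
    [MeasurableSpace K] [BorelSpace K] {S : ConvData K} (hS : IsCommHypergroup S)

include hS

theorem isOpen_support_subset {U : Set K} (hU : IsOpen U) :
    IsOpen {q : K × K | (S.conv q.1 q.2).support ⊆ U} :=
  (TopologicalSpace.vietoris.continuous_iff.1 hS.continuous_support).1 U hU

theorem isOpen_support_inter {U : Set K} (hU : IsOpen U) :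
    IsOpen {q : K × K | ((S.conv q.1 q.2).support ∩ U).Nonempty} :=
  (@Continuous.isOpen_preimage _ _ _ (TopologicalSpace.vietoris K) _ hS.continuous_support _
    (TopologicalSpace.vietoris.isOpen_inter_nonempty_of_isOpen hU) :)

theorem support_nonempty (x y : K) : (S.conv x y).support.Nonempty := by
  have := hS.isProbability x y
  have := hS.regular x y
  have h : ∫ t, (1 : ℝ) ∂S.conv x y ≠ 0 := by simp
  obtain ⟨t, ht, -⟩ := exists_mem_support_ne_zero h
  exact ⟨t, ht⟩

theorem support_one_conv (x : K) : (S.conv S.one x).support = {x} := by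
  have := hS.regular S.one x
  have hsub : (S.conv S.one x).support ⊆ {x} := by
    apply Measure.support_subset_of_isClosed isClosed_singleton
    rw [hS.one_conv, mem_ae_iff, Measure.dirac_apply' _ (isClosed_singleton.measurableSet.compl)]
    simp
  exact (hS.support_nonempty S.one x).subset_singleton_iff.1 hsub

theorem support_conv_one (x : K) : (S.conv x S.one).support = {x} := by
  rw [hS.comm, hS.support_one_conv]

theorem inv_one : S.inv S.one = S.one := by
  have : S.one ∈ (S.conv S.one S.one).support := by rw [hS.support_one_conv]; rfl
  exact ((hS.one_mem_support _ _).1 this).symm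

/-- By Vietoris continuity, `supp ω(x, y) ⊆ U` persists near `(x, y)`. Compactness of `C` then
globalizes two local facts: separation from a point outside the union (closedness) and containment
in a compact set. -/
theorem isCompact_iUnion_support {C : Set (K × K)} (hC : IsCompact C) :
    IsCompact (⋃ q ∈ C, (S.conv q.1 q.2).support) := by
  have key : ∀ q : K × K, ∀ U, IsOpen U → (S.conv q.1 q.2).support ⊆ U →
      {q : K × K | (S.conv q.1 q.2).support ⊆ U} ∈ 𝓝 q := fun q U hU h =>
    (hS.isOpen_support_subset hU).mem_nhds h
  have hclosed : IsClosed (⋃ q ∈ C, (S.conv q.1 q.2).support) := by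
    rw [← isOpen_compl_iff, isOpen_iff_mem_nhds]
    intro z hz
    have hz' : ∀ q ∈ C, z ∉ (S.conv q.1 q.2).support := by simpa using hz
    refine hC.induction_on (p := fun D => (⋃ q ∈ D, (S.conv q.1 q.2).support)ᶜ ∈ 𝓝 z)
      (by simp) (fun s t hst ht => mem_of_superset ht
        (compl_subset_compl.2 (biUnion_subset_biUnion_left hst))) (fun s t hs ht => ?_)
      fun q hq => ?_
    · rw [biUnion_union, compl_union]
      exact inter_mem hs ht
    · obtain ⟨U, V, hU, hV, hsU, hzV, hd⟩ :=
        (hS.isCompact_support q.1 q.2).separation_of_notMem (hz' q hq)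
      refine ⟨_, mem_nhdsWithin_of_mem_nhds (key q U hU hsU), ?_⟩
      filter_upwards [hV.mem_nhds hzV] with w hw hw'
      simp only [mem_iUnion] at hw'
      obtain ⟨q', hq', hw'⟩ := hw'
      exact hd.le_bot ⟨hq' hw', hw⟩
  have hsub : ∃ D, IsCompact D ∧ (⋃ q ∈ C, (S.conv q.1 q.2).support) ⊆ D := by
    refine hC.induction_on
      (p := fun C => ∃ D, IsCompact D ∧ (⋃ q ∈ C, (S.conv q.1 q.2).support) ⊆ D)
      ⟨∅, isCompact_empty, by simp⟩ (fun s t hst ⟨D, hD, h⟩ => ⟨D, hD,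
        (biUnion_subset_biUnion_left hst).trans h⟩) ?_ fun q hq => ?_
    · rintro s t ⟨D, hD, h⟩ ⟨D', hD', h'⟩
      refine ⟨D ∪ D', hD.union hD', ?_⟩
      rw [biUnion_union]
      exact union_subset_union h h'
    · obtain ⟨D, hD, h⟩ := exists_compact_superset (hS.isCompact_support q.1 q.2)
      refine ⟨_, mem_nhdsWithin_of_mem_nhds (key q _ isOpen_interior h), D, hD, ?_⟩
      simp only [iUnion_subset_iff]
      exact fun q' hq' => Subset.trans hq' interior_subset
  obtain ⟨D, hD, h⟩ := hsub
  exact hD.of_isClosed_subset hclosed h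

theorem isCompact_setMul {A B : Set K} (hA : IsCompact A) (hB : IsCompact B) :
    IsCompact (S.setMul A B) := by
  convert hS.isCompact_iUnion_support (hA.prod hB) using 1
  ext z
  simp [ConvData.setMul, and_assoc]

theorem continuous_integral_complex (f : K →ᵇ ℂ) :
    Continuous fun q : K × K => ∫ t, f t ∂S.conv q.1 q.2 := by
  have hre := hS.continuous_conv
    (BoundedContinuousFunction.comp Complex.re Complex.reCLM.lipschitz f)
  have him := hS.continuous_conv
    (BoundedContinuousFunction.comp Complex.im Complex.imCLM.lipschitz f)
  have : (fun q : K × K => ∫ t, f t ∂S.conv q.1 q.2) = fun q =>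
      ((∫ t, (f t).re ∂S.conv q.1 q.2 : ℝ) : ℂ)
        + ((∫ t, (f t).im ∂S.conv q.1 q.2 : ℝ) : ℂ) * Complex.I := by
    ext q
    have := hS.isProbability q.1 q.2
    exact (integral_re_add_im (f.integrable _)).symm
  rw [this]
  exact (Complex.continuous_ofReal.comp hre).add
    ((Complex.continuous_ofReal.comp him).mul continuous_const)

theorem assoc_complex (f : K →ᵇ ℂ) (x y z : K) :
    ∫ u, (∫ t, f t ∂S.conv u z) ∂S.conv x y = ∫ u, (∫ t, f t ∂S.conv x u) ∂S.conv y z := by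
  have hre := hS.assoc
    (BoundedContinuousFunction.comp Complex.re Complex.reCLM.lipschitz f) x y z
  have him := hS.assoc
    (BoundedContinuousFunction.comp Complex.im Complex.imCLM.lipschitz f) x y z
  have hb : ∀ a b, ‖∫ t, f t ∂S.conv a b‖ ≤ ‖f‖ := fun a b => by
    have := hS.isProbability a b
    exact f.norm_integral_le_norm _
  have hint : ∀ a b, Integrable f (S.conv a b) := fun a b => by
    have := hS.isProbability a b
    exact f.integrable _
  have h1 : Integrable (fun u => ∫ t, f t ∂S.conv u z) (S.conv x y) := by
    have := hS.isProbability x y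
    exact (BoundedContinuousFunction.ofNormedAddCommGroup _ ((hS.continuous_integral_complex f).comp
      (Continuous.prodMk_left z)) ‖f‖ fun u => hb u z).integrable _
  have h2 : Integrable (fun u => ∫ t, f t ∂S.conv x u) (S.conv y z) := by
    have := hS.isProbability y z
    exact (BoundedContinuousFunction.ofNormedAddCommGroup _ ((hS.continuous_integral_complex f).comp
      (Continuous.prodMk_right x)) ‖f‖ fun u => hb x u).integrable _
  have e1 : ∀ a b, (∫ t, f t ∂S.conv a b).re = ∫ t, (f t).re ∂S.conv a b := fun a b =>
    (integral_re (hint a b)).symm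
  have e2 : ∀ a b, (∫ t, f t ∂S.conv a b).im = ∫ t, (f t).im ∂S.conv a b := fun a b =>
    (integral_im (hint a b)).symm
  apply Complex.ext
  · have a1 := integral_re h1
    have a2 := integral_re h2
    simp only [RCLike.re_to_complex] at a1 a2
    rw [← a1, ← a2]
    simp only [e1]
    exact hre
  · have a1 := integral_im h1
    have a2 := integral_im h2
    simp only [RCLike.im_to_complex] at a1 a2
    rw [← a1, ← a2]
    simp only [e2]
    exact him

/-- Associativity on the level of supports. -/
theorem exists_mem_support_assoc {x y z t u : K} (hu : u ∈ (S.conv x y).support)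
    (ht : t ∈ (S.conv u z).support) :
    ∃ w ∈ (S.conv y z).support, t ∈ (S.conv x w).support := by
  have hcl : IsClosed (S.setMul {x} (S.conv y z).support) :=
    (hS.isCompact_setMul isCompact_singleton (hS.isCompact_support y z)).isClosed
  suffices t ∈ S.setMul {x} (S.conv y z).support by simpa [ConvData.setMul] using this
  by_contra hnot
  obtain ⟨f, hfc, hf1, hf0, -, hfs⟩ := exists_bump isCompact_singleton hcl.isOpen_compl
    (singleton_subset_iff.2 hnot)
  have := hS.isProbability x y
  have := hS.isProbability u z
  have hpos : 0 < ∫ v, (∫ s, f s ∂S.conv v z) ∂S.conv x y := by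
    refine integral_pos_of_mem_support (BoundedContinuousFunction.ofNormedAddCommGroup
      (fun v => ∫ s, f s ∂S.conv v z) ((hS.continuous_conv f).comp
      (Continuous.prodMk_left z)) ‖f‖ fun u => ?_) (fun v => integral_nonneg hf0) hu
      (integral_pos_of_mem_support f hf0 ht (by rw [hf1 t rfl]; exact one_pos))
    have := hS.isProbability u z
    exact f.norm_integral_le_norm _
  rw [hS.assoc] at hpos
  have := hS.regular y z
  obtain ⟨w, hw, hw'⟩ := exists_mem_support_ne_zero hpos.ne'
  have := hS.regular x w
  obtain ⟨s, hs, hs'⟩ := exists_mem_support_ne_zero hw'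
  refine hfs (subset_tsupport _ hs') ?_
  simp only [ConvData.setMul, mem_iUnion]
  exact ⟨x, rfl, w, hw, hs⟩

/-- As `e ∈ supp ω(z, z~)`, associativity gives `w ∈ supp ω(y, z~)` with `e ∈ supp ω(x, w)`. Hence
`x = w~`, and applying the involution to `w` finishes. -/
theorem mem_support_reverse {x y z : K} (h : z ∈ (S.conv x y).support) :
    x ∈ (S.conv z (S.inv y)).support := by
  have h1 : S.one ∈ (S.conv z (S.inv z)).support :=
    (hS.one_mem_support _ _).2 (hS.inv_inv z).symm
  obtain ⟨w, hw, hw'⟩ := hS.exists_mem_support_assoc h h1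
  have hxw := (hS.one_mem_support _ _).1 hw'
  have hinv := hS.map_inv y (S.inv z)
  have hw2 : S.inv w ∈ ((S.conv y (S.inv z)).map S.inv).support := by
    rw [Measure.mem_support_iff_forall] at hw ⊢
    intro U hU
    refine (hw _ (hS.continuous_inv.continuousAt.preimage_mem_nhds hU)).trans_le ?_
    exact Measure.le_map_apply hS.continuous_inv.aemeasurable U
  rw [hinv, hS.inv_inv] at hw2
  rwa [hxw]

theorem mem_support_reverse_iff {x y z : K} :
    z ∈ (S.conv x y).support ↔ x ∈ (S.conv z (S.inv y)).support :=
  ⟨hS.mem_support_reverse, fun h => by simpa [hS.inv_inv] using hS.mem_support_reverse h⟩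

theorem mem_support_reverse' {x y z : K} (h : z ∈ (S.conv x y).support) :
    y ∈ (S.conv (S.inv x) z).support := by
  rw [hS.comm] at h ⊢
  exact hS.mem_support_reverse h

theorem mem_support_inv {x y z : K} (h : z ∈ (S.conv x y).support) :
    S.inv z ∈ (S.conv (S.inv x) (S.inv y)).support := by
  rw [hS.comm, ← hS.map_inv]
  rw [Measure.mem_support_iff_forall] at h ⊢
  intro U hU
  refine (h _ (hS.continuous_inv.continuousAt.preimage_mem_nhds hU)).trans_le ?_
  exact Measure.le_map_apply hS.continuous_inv.aemeasurable U

end IsCommHypergroup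

/-- Fubini for a compactly supported finite Radon measure `μ`, a measure `ν` that is finite on
compact sets, a continuous kernel with compact support in the second variable and a bounded
measurable weight. -/
theorem integral_integral_swap_smul {X Y E : Type*} [TopologicalSpace X] [T2Space X]
    [LocallyCompactSpace X] [MeasurableSpace X] [BorelSpace X]
    [TopologicalSpace Y] [T2Space Y] [MeasurableSpace Y] [BorelSpace Y]
    [NormedAddCommGroup E] [NormedSpace ℝ E] [CompleteSpace E]
    (μ : Measure X) [IsFiniteMeasure μ] [μ.Regular] (hμ : IsCompact μ.support)
    (ν : Measure Y) [IsFiniteMeasureOnCompacts ν] {F : X → Y → ℝ} (hF : Continuous F.uncurry)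
    {C : Set Y} (hC : IsCompact C) (hFC : ∀ x, ∀ y ∉ C, F x y = 0)
    {φ : Y → E} (hφ : AEStronglyMeasurable φ ν) {M : ℝ} (hφM : ∀ᵐ y ∂ν, ‖φ y‖ ≤ M) :
    ∫ x, ∫ y, F x y • φ y ∂ν ∂μ = ∫ y, (∫ x, F x y ∂μ) • φ y ∂ν := by
  -- The cutoff `b` equals `1` on `supp μ`, so it changes no integral but makes the kernel compactly
  -- supported on the product. Restricting `ν` to `C` makes it finite, so Fubini applies although
  -- `ν` need not be σ-finite.
  obtain ⟨b, hbc, hb1, -, -, -⟩ := exists_bump hμ isOpen_univ (subset_univ _)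
  have hG : Continuous (fun q : X × Y => b q.1 * F q.1 q.2) :=
    (b.continuous.comp continuous_fst).mul hF
  have hGc : HasCompactSupport (fun q : X × Y => b q.1 * F q.1 q.2) := by
    refine HasCompactSupport.intro (hbc.isCompact.prod hC) fun q hq => ?_
    by_contra h
    refine hq ⟨subset_tsupport _ (left_ne_zero_of_mul h), ?_⟩
    by_contra hc
    exact right_ne_zero_of_mul h (hFC _ _ hc)
  have : Fact (ν C < ⊤) := ⟨hC.measure_lt_top⟩
  have hint : Integrable (Function.uncurry fun x y => (b x * F x y) • φ y)
      (μ.prod (ν.restrict C)) := by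
    obtain ⟨B, hB⟩ := hG.bounded_above_of_compact_support hGc
    -- Without second countability, continuity alone does not give measurability for the product
    -- σ-algebra; compact support does.
    refine Integrable.of_bound ((hGc.stronglyMeasurable_of_prod hG).aestronglyMeasurable.smul
      (hφ.restrict (s := C)).comp_snd) (B * M) ?_
    have h2 : ∀ᵐ q ∂μ.prod (ν.restrict C), ‖φ q.2‖ ≤ M :=
      Measure.quasiMeasurePreserving_snd.ae (ae_restrict_of_ae hφM)
    filter_upwards [h2] with q hq
    rw [Function.uncurry_def, norm_smul]
    exact mul_le_mul (hB q) hq (norm_nonneg _) ((norm_nonneg _).trans (hB q))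
  calc ∫ x, ∫ y, F x y • φ y ∂ν ∂μ = ∫ x, ∫ y in C, (b x * F x y) • φ y ∂ν ∂μ := by
        refine integral_congr_support fun x hx => ?_
        simp only [hb1 x hx, one_mul]
        exact (setIntegral_eq_integral_of_forall_compl_eq_zero
          fun y hy => by rw [hFC x y hy, zero_smul]).symm
    _ = ∫ y in C, ∫ x, (b x * F x y) • φ y ∂μ ∂ν := integral_integral_swap hint
    _ = ∫ y in C, (∫ x, F x y ∂μ) • φ y ∂ν := by
        refine integral_congr_ae (.of_forall fun y => ?_)
        simp only [integral_smul_const]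
        congr 1
        exact integral_congr_support fun x hx => by rw [hb1 x hx, one_mul]
    _ = ∫ y, (∫ x, F x y ∂μ) • φ y ∂ν :=
        setIntegral_eq_integral_of_forall_compl_eq_zero fun y hy => by simp [hFC _ y hy]

/-- The translate `T_x f (y) = ∫ f dω(x, y)` of a vector valued function. -/
def ConvData.avg {K E : Type*} [MeasurableSpace K] [NormedAddCommGroup E] [NormedSpace ℝ E]
    (S : ConvData K) (x : K) (f : K → E) (y : K) : E := ∫ t, f t ∂S.conv x y

theorem ConvData.avg_nonneg {K : Type*} [MeasurableSpace K] (S : ConvData K) {f : K → ℝ}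
    (hf : ∀ t, 0 ≤ f t) (x y : K) : 0 ≤ S.avg x f y :=
  integral_nonneg hf

theorem ConvData.IsHaar.integral_avg {K : Type*} [TopologicalSpace K] [MeasurableSpace K]
    {S : ConvData K} {m : Measure K} (hm : S.IsHaar m) (x : K) {f : K → ℝ} (hf : Continuous f)
    (hc : HasCompactSupport f) : ∫ y, S.avg x f y ∂m = ∫ y, f y ∂m := by
  have h := hm.integral_translate x (fun t => (f t : ℂ)) (Complex.continuous_ofReal.comp hf)
    (hc.comp_left Complex.ofReal_zero)
  simp only [ConvData.translate, integral_complex_ofReal] at h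
  exact_mod_cast h

/-! ### Translates of continuous functions. -/

namespace IsCommHypergroup

variable {K : Type*} [TopologicalSpace K] [T2Space K] [LocallyCompactSpace K]
    [MeasurableSpace K] [BorelSpace K] {S : ConvData K} (hS : IsCommHypergroup S)

include hS

theorem continuous_avg_uncurry (f : K →ᵇ ℝ) : Continuous fun q : K × K => S.avg q.1 f q.2 :=
  hS.continuous_conv f

theorem continuous_avg (x : K) (f : K →ᵇ ℝ) : Continuous (S.avg x f) :=
  (hS.continuous_avg_uncurry f).comp (Continuous.prodMk_right x)

theorem abs_avg_le (x : K) (f : K →ᵇ ℝ) (y : K) : ‖S.avg x f y‖ ≤ ‖f‖ := by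
  have := hS.isProbability x y
  exact f.norm_integral_le_norm _

/-- The translate of a bounded continuous function as a bounded continuous function. -/
def avgBcf (x : K) (f : K →ᵇ ℝ) : K →ᵇ ℝ :=
  BoundedContinuousFunction.ofNormedAddCommGroup (S.avg x f) (hS.continuous_avg x f) ‖f‖
    (hS.abs_avg_le x f)

@[simp] theorem coe_avgBcf (x : K) (f : K →ᵇ ℝ) : ⇑(hS.avgBcf x f) = S.avg x f := rfl

theorem avg_one_left (f : K →ᵇ ℝ) (y : K) : S.avg S.one f y = f y := by
  rw [ConvData.avg, hS.one_conv, integral_dirac]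

theorem avg_swap {E : Type*} [NormedAddCommGroup E] [NormedSpace ℝ E] (f : K → E) (x y : K) :
    S.avg x f y = S.avg y f x := by
  rw [ConvData.avg, ConvData.avg, hS.comm]

theorem exists_of_avg_ne_zero {f : K → ℝ} {x y : K} (h : S.avg x f y ≠ 0) :
    ∃ t ∈ (S.conv x y).support, f t ≠ 0 := by
  have := hS.regular x y
  exact exists_mem_support_ne_zero h

/-- For compact `D` and `tsupport f` this is a compact set carrying all `T_x f`, `x ∈ D`, at once,
as needed for integrals depending on `x`. -/
theorem mem_setMul_of_avg_ne_zero {f : K → ℝ} {D : Set K} {x y : K} (hx : x ∈ D)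
    (h : S.avg x f y ≠ 0) : y ∈ S.setMul (S.inv '' D) (tsupport f) := by
  obtain ⟨t, ht, hft⟩ := hS.exists_of_avg_ne_zero h
  simp only [ConvData.setMul, mem_iUnion]
  exact ⟨_, mem_image_of_mem _ hx, t, subset_tsupport _ hft, hS.mem_support_reverse' ht⟩

theorem hasCompactSupport_avg {f : K → ℝ} (hf : HasCompactSupport f) (x : K) :
    HasCompactSupport (S.avg x f) := by
  refine HasCompactSupport.intro (hS.isCompact_setMul
    ((isCompact_singleton (x := x)).image hS.continuous_inv) hf.isCompact) fun y hy => ?_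
  by_contra h
  exact hy (hS.mem_setMul_of_avg_ne_zero (mem_singleton x) h)

theorem avg_avg (f : K →ᵇ ℝ) (x y z : K) :
    S.avg x (S.avg y f) z = ∫ w, S.avg w f z ∂S.conv x y := by
  rw [hS.comm x y]
  exact (hS.assoc f y x z).symm

theorem avg_comm (f : K →ᵇ ℝ) (x y z : K) :
    S.avg x (S.avg y f) z = S.avg y (S.avg x f) z := by
  rw [hS.avg_avg, hS.avg_avg, hS.comm]

theorem integral_comp_inv {E : Type*} [NormedAddCommGroup E] [NormedSpace ℝ E] (f : K → E)
    (x y : K) :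
    ∫ t, f (S.inv t) ∂S.conv x y = ∫ t, f t ∂S.conv (S.inv x) (S.inv y) := by
  rw [hS.comm (S.inv x), ← hS.map_inv]
  let e : K ≃ₜ K := ⟨⟨S.inv, S.inv, hS.inv_inv, hS.inv_inv⟩, hS.continuous_inv, hS.continuous_inv⟩
  exact (e.measurableEmbedding.integral_map f).symm

/-- Uniform continuity on compact sets, in terms of neighbourhoods of the identity. -/
theorem exists_nhds_one_uniform {f : K → ℝ} (hf : Continuous f) {C : Set K} (hC : IsCompact C)
    {ε : ℝ} (hε : 0 < ε) :
    ∃ U ∈ 𝓝 S.one, ∀ u ∈ C, ∀ w ∈ U, ∀ z ∈ (S.conv u w).support, |f z - f u| < ε := by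
  refine hC.induction_on (p := fun C => ∃ U ∈ 𝓝 S.one, ∀ u ∈ C, ∀ w ∈ U,
    ∀ z ∈ (S.conv u w).support, |f z - f u| < ε) ⟨univ, univ_mem, by simp⟩
    (fun s t hst ⟨U, hU, h⟩ => ⟨U, hU, fun u hu => h u (hst hu)⟩) ?_ fun u hu => ?_
  · rintro s t ⟨U, hU, h⟩ ⟨V, hV, h'⟩
    refine ⟨U ∩ V, inter_mem hU hV, fun u hu w hw => ?_⟩
    rcases hu with hu | hu
    · exact h u hu w hw.1
    · exact h' u hu w hw.2
  · let V := {z | |f z - f u| < ε / 2}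
    have hV : IsOpen V := isOpen_lt (by fun_prop) continuous_const
    have huV : u ∈ V := by simp [V, hε]
    have hn : {q : K × K | (S.conv q.1 q.2).support ⊆ V} ∈ 𝓝 (u, S.one) := by
      refine (hS.isOpen_support_subset hV).mem_nhds ?_
      simpa only [mem_ofPred_eq, hS.support_conv_one, singleton_subset_iff] using huV
    rw [nhds_prod_eq, mem_prod_iff] at hn
    obtain ⟨N, hN, U, hU, h⟩ := hn
    refine ⟨N ∩ V, mem_nhdsWithin_of_mem_nhds (inter_mem hN (hV.mem_nhds huV)), U, hU, ?_⟩
    intro u' hu' w hw z hz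
    have h1 : |f z - f u| < ε / 2 := @h (u', w) ⟨hu'.1, hw⟩ z hz
    have h2 : |f u' - f u| < ε / 2 := hu'.2
    rw [abs_lt] at h1 h2 ⊢
    constructor <;> linarith [h1.1, h1.2, h2.1, h2.2]

theorem avg_inv_symm {k : K →ᵇ ℝ} (hk : ∀ t, k (S.inv t) = k t) (x y : K) :
    S.avg x k (S.inv y) = S.avg (S.inv x) k y := by
  have := hS.integral_comp_inv k x (S.inv y)
  rw [hS.inv_inv] at this
  simp only [hk] at this
  exact this

/-! ### Positivity of Haar measures and the adjoint of a translation on `C_c`. -/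

section Haar

variable {m : Measure K} (hm : S.IsHaar m)

include hm

/-- Invariance carries mass from a point `b` of `supp m` to any `a ∈ U`: for `x ∈ supp ω(a, b~)` one
has `a ∈ supp ω(x, b)`, so `T_x f(b) > 0` for a bump `f` at `a`. But `∫ T_x f dm = ∫ f dm` would
vanish if `U` were null. -/
theorem isOpenPosMeasure : m.IsOpenPosMeasure := by
  have := hm.innerRegular
  have := hm.finiteOnCompacts
  obtain ⟨b, hb⟩ : m.support.Nonempty := by
    rw [nonempty_iff_ne_empty]
    intro h
    have := Measure.measure_compl_support_of_innerRegular (μ := m)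
    rw [h, compl_empty, Measure.measure_univ_eq_zero] at this
    exact hm.ne_zero this
  refine ⟨fun U hU ⟨a, ha⟩ h0 => ?_⟩
  obtain ⟨f, hfc, hf1, hf0, -, hfs⟩ := exists_bump isCompact_singleton hU (singleton_subset_iff.2 ha)
  obtain ⟨x, hx⟩ := hS.support_nonempty a (S.inv b)
  have ha' : a ∈ (S.conv x b).support := hS.mem_support_reverse_iff.2 hx
  have hi : ∫ y, f y ∂m = 0 := by
    have : f =ᵐ[m] fun _ => 0 := by
      filter_upwards [measure_eq_zero_iff_ae_notMem.1 h0] with y hy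
      by_contra h
      exact hy (hfs (subset_tsupport _ h))
    rw [integral_congr_ae this]; simp
  rw [← hm.integral_avg x f.continuous hfc] at hi
  have hcont := hS.continuous_avg x f
  have hpos : 0 < S.avg x f b := by
    have := hS.isProbability x b
    exact integral_pos_of_mem_support f hf0 ha' (by rw [hf1 a rfl]; exact one_pos)
  rw [integral_eq_zero_iff_of_nonneg (fun y => S.avg_nonneg hf0 x y)
    (hcont.integrable_of_hasCompactSupport (hS.hasCompactSupport_avg hfc x))] at hi
  have hmeas := (Measure.mem_support_iff_forall b).1 hb _
    (hcont.isOpen_support.mem_nhds hpos.ne')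
  exact hmeas.ne' (measure_eq_zero_iff_ae_notMem.2 (by
    filter_upwards [hi] with y hy h using h hy))

/-- Symmetric bumps near the identity. -/
theorem exists_symm_bump {U : Set K} (hU : U ∈ 𝓝 S.one) :
    ∃ k : K →ᵇ ℝ, HasCompactSupport k ∧ (∀ t, 0 ≤ k t) ∧ (∀ t, k (S.inv t) = k t) ∧
      (∀ t, k t ≠ 0 → t ∈ U) ∧ 0 < ∫ t, k t ∂m := by
  have := hS.isOpenPosMeasure hm
  have := hm.finiteOnCompacts
  have hV : interior U ∩ S.inv ⁻¹' interior U ∈ 𝓝 S.one := by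
    refine inter_mem (interior_mem_nhds.2 hU) (hS.continuous_inv.continuousAt.preimage_mem_nhds ?_)
    rw [hS.inv_one]
    exact interior_mem_nhds.2 hU
  obtain ⟨b, hbc, hb1, hb0, -, hbs⟩ := exists_bump isCompact_singleton
    (isOpen_interior.inter (isOpen_interior.preimage hS.continuous_inv))
    (singleton_subset_iff.2 (mem_of_mem_nhds hV))
  let e : K ≃ₜ K := ⟨⟨S.inv, S.inv, hS.inv_inv, hS.inv_inv⟩, hS.continuous_inv, hS.continuous_inv⟩
  let b' : K →ᵇ ℝ := b.compContinuous ⟨S.inv, hS.continuous_inv⟩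
  have hb'c : HasCompactSupport b' := hbc.comp_homeomorph e
  have hkc : HasCompactSupport (b + b') := hbc.add hb'c
  have hk0 : ∀ t, 0 ≤ (b + b') t := fun t => add_nonneg (hb0 t) (hb0 _)
  refine ⟨b + b', hkc, hk0, fun t => ?_, fun t ht => ?_, ?_⟩
  · change b (S.inv t) + b (S.inv (S.inv t)) = b t + b (S.inv t)
    rw [hS.inv_inv, add_comm]
  · by_contra h
    have h1 : b t = 0 := by
      by_contra hb
      exact h (interior_subset (hbs (subset_tsupport _ hb)).1)
    have h2 : b (S.inv t) = 0 := by
      by_contra hb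
      have := (hbs (subset_tsupport _ hb)).2
      simp only [mem_preimage, hS.inv_inv] at this
      exact h (interior_subset this)
    exact ht (by change b t + b (S.inv t) = 0; rw [h1, h2, add_zero])
  · refine (b + b').continuous.integral_pos_of_hasCompactSupport_nonneg_nonzero hkc hk0 (x := S.one) ?_
    change b S.one + b (S.inv S.one) ≠ 0
    rw [hS.inv_one, hb1 _ rfl]
    norm_num

/-- The kernel `T_{z~} k(u)` is an unnormalized approximate identity. As `k` is symmetric it equals
`T_{u~} k(z)`, whose integral in `z` is `∫ k dm`, and it vanishes unless `z ∈ supp ω(u, w)` with `k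
w ≠ 0`. -/
theorem abs_integral_kernel_sub_le {k : K →ᵇ ℝ} (hkc : HasCompactSupport k) (hk0 : ∀ t, 0 ≤ k t)
    (hk : ∀ t, k (S.inv t) = k t) {g : K → ℝ} (hg : Continuous g) (hgc : HasCompactSupport g)
    {ε : ℝ} {u : K}
    (h : ∀ w, k w ≠ 0 → ∀ z ∈ (S.conv u w).support, |g z - g u| < ε) :
    |∫ z, g z * S.avg (S.inv z) k u ∂m - g u * ∫ t, k t ∂m| ≤ ε * ∫ t, k t ∂m := by
  have := hm.finiteOnCompacts
  have hker : ∀ z, S.avg (S.inv z) k u = S.avg (S.inv u) k z := fun z => by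
    rw [hS.avg_swap, hS.avg_inv_symm hk]
  simp only [hker]
  have hkint := hm.integral_avg (S.inv u) k.continuous hkc
  have hc := hS.continuous_avg (S.inv u) k
  have hcc := hS.hasCompactSupport_avg hkc (S.inv u)
  have i1 : Integrable (fun z => g z * S.avg (S.inv u) k z) m :=
    (hg.mul hc).integrable_of_hasCompactSupport hgc.mul_right
  have i2 : Integrable (S.avg (S.inv u) k) m := hc.integrable_of_hasCompactSupport hcc
  rw [← hkint, ← integral_const_mul, ← integral_const_mul, ← integral_sub i1 (i2.const_mul _),
    ← Real.norm_eq_abs]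
  refine norm_integral_le_of_norm_le (i2.const_mul ε) (.of_forall fun z => ?_)
  rw [← sub_mul, norm_mul, Real.norm_of_nonneg (S.avg_nonneg hk0 _ _)]
  by_cases h0 : S.avg (S.inv u) k z = 0
  · simp [h0]
  · obtain ⟨w, hw, hkw⟩ := hS.exists_of_avg_ne_zero h0
    refine mul_le_mul_of_nonneg_right ?_ (S.avg_nonneg hk0 _ _)
    have := hS.mem_support_reverse' hw
    rw [hS.inv_inv] at this
    exact (h w hkw z this).le

/-- The preceding estimate at the points `u ∈ supp ω(x, y)`, integrated against `ω(x, y)` and then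
against `f m`. -/
theorem abs_integral_kernel_avg_sub_le {k : K →ᵇ ℝ} (hkc : HasCompactSupport k)
    (hk0 : ∀ t, 0 ≤ k t) (hk : ∀ t, k (S.inv t) = k t)
    {f g : K → ℝ} (hf : Continuous f) (hfc : HasCompactSupport f)
    (hg : Continuous g) (hgc : HasCompactSupport g) {ε : ℝ} (x : K)
    (h : ∀ y ∈ tsupport f, ∀ u ∈ (S.conv x y).support,
      ∀ w, k w ≠ 0 → ∀ z ∈ (S.conv u w).support, |g z - g u| < ε) :
    |∫ y, f y * (∫ z, g z * S.avg x (S.avg (S.inv z) k) y ∂m) ∂m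
      - (∫ t, k t ∂m) * ∫ y, f y * S.avg x g y ∂m| ≤ ε * (∫ t, k t ∂m) * ∫ y, |f y| ∂m := by
  have := hm.finiteOnCompacts
  set c := ∫ t, k t ∂m
  let gb : K →ᵇ ℝ := bcfOfCompactSupport g hg hgc
  have hcont : Continuous fun q : K × K => g q.1 * S.avg (S.inv q.1) k q.2 :=
    (hg.comp continuous_fst).mul ((hS.continuous_avg_uncurry k).comp
      ((hS.continuous_inv.comp continuous_fst).prodMk continuous_snd))
  have hswap : ∀ y, ∫ z, g z * S.avg x (S.avg (S.inv z) k) y ∂m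
      = ∫ u, (∫ z, g z * S.avg (S.inv z) k u ∂m) ∂S.conv x y := fun y => by
    have := hS.isProbability x y
    have := hS.regular x y
    have := integral_integral_swap_smul (S.conv x y) (hS.isCompact_support x y) m
      (F := fun u z => g z * S.avg (S.inv z) k u)
      (hcont.comp continuous_swap) hgc.isCompact
      (fun u z hz => by simp only [image_eq_zero_of_notMem_tsupport hz, zero_mul])
      (φ := fun _ => (1 : ℝ)) aestronglyMeasurable_const (M := 1) (by simp)
    simp only [smul_eq_mul, mul_one, integral_const_mul] at this
    exact this.symm
  have hkcont : Continuous fun u => ∫ z, g z * S.avg (S.inv z) k u ∂m := by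
    have := continuousOn_integral_of_compact_support (μ := m) (s := univ)
      (f := fun u z => g z * S.avg (S.inv z) k u) hgc.isCompact
      (hcont.comp continuous_swap).continuousOn
      (fun u z _ hz => by simp only [image_eq_zero_of_notMem_tsupport hz, zero_mul])
    rwa [continuousOn_univ] at this
  have hpt : ∀ y ∈ tsupport f, |∫ z, g z * S.avg x (S.avg (S.inv z) k) y ∂m - c * S.avg x g y|
      ≤ ε * c := fun y hy => by
    have := hS.isProbability x y
    have := hS.regular x y
    have hi1 := integrable_of_isCompact_support (hS.isCompact_support x y) hkcont
    have hi2 : Integrable g (S.conv x y) := gb.integrable _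
    rw [hswap, ConvData.avg, ← integral_const_mul, ← integral_sub hi1
      (hi2.const_mul c), ← Real.norm_eq_abs]
    refine (norm_integral_le_of_norm_le_const (C := ε * c) ?_).trans (by simp)
    filter_upwards [Measure.support_mem_ae_of_regular (μ := S.conv x y)] with u hu
    rw [mul_comm c]
    exact hS.abs_integral_kernel_sub_le hm hkc hk0 hk hg hgc (h y hy u hu)
  have hk3 : Continuous fun y => ∫ z, g z * S.avg x (S.avg (S.inv z) k) y ∂m := by
    have h3 : Continuous fun q : K × K => g q.2 * S.avg x (S.avg (S.inv q.2) k) q.1 := by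
      simp_rw [hS.avg_comm k x]
      exact (hg.comp continuous_snd).mul ((hS.continuous_avg_uncurry (hS.avgBcf x k)).comp
        ((hS.continuous_inv.comp continuous_snd).prodMk continuous_fst))
    have := continuousOn_integral_of_compact_support (μ := m) (s := univ)
      (f := fun y z => g z * S.avg x (S.avg (S.inv z) k) y) hgc.isCompact h3.continuousOn
      (fun u z _ hz => by simp only [image_eq_zero_of_notMem_tsupport hz, zero_mul])
    rwa [continuousOn_univ] at this
  have i1 : Integrable (fun y => f y * (∫ z, g z * S.avg x (S.avg (S.inv z) k) y ∂m)) m :=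
    (hf.mul hk3).integrable_of_hasCompactSupport hfc.mul_right
  have i2 : Integrable (fun y => f y * S.avg x g y) m :=
    (hf.mul (hS.continuous_avg x gb)).integrable_of_hasCompactSupport hfc.mul_right
  rw [← integral_const_mul, ← integral_const_mul, ← integral_sub i1 (i2.const_mul c),
    ← Real.norm_eq_abs]
  refine norm_integral_le_of_norm_le
    ((hf.abs.integrable_of_hasCompactSupport (hfc.comp_left abs_zero)).const_mul _)
    (.of_forall fun y => ?_)
  by_cases hy : y ∈ tsupport f
  · have : f y * (∫ z, g z * S.avg x (S.avg (S.inv z) k) y ∂m) - c * (f y * S.avg x g y)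
        = (∫ z, g z * S.avg x (S.avg (S.inv z) k) y ∂m - c * S.avg x g y) * f y := by ring
    rw [this, norm_mul]
    exact mul_le_mul_of_nonneg_right (hpt y hy) (abs_nonneg _)
  · simp [image_eq_zero_of_notMem_tsupport hy]

/-- The adjoint of `T_x` with respect to a Haar measure is `T_{x~}`. -/
theorem integral_avg_mul {f g : K → ℝ} (hf : Continuous f) (hfc : HasCompactSupport f)
    (hg : Continuous g) (hgc : HasCompactSupport g) (x : K) :
    ∫ y, S.avg x f y * g y ∂m = ∫ y, f y * S.avg (S.inv x) g y ∂m := by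
  have := hm.finiteOnCompacts
  set A := ∫ y, |f y| ∂m
  set B := ∫ y, |g y| ∂m
  have hA : 0 ≤ A := integral_nonneg fun _ => abs_nonneg _
  have hB : 0 ≤ B := integral_nonneg fun _ => abs_nonneg _
  -- The single double integral of `f(y) g(z) T_x T_{y~} k(z)`, taken in both orders, is close to `∫
  -- k` times either side. The errors are `ε B ∫ k` and `ε A ∫ k`, so `∫ k > 0` cancels.
  have key : ∀ ε > 0, |∫ y, g y * S.avg x f y ∂m - ∫ y, f y * S.avg (S.inv x) g y ∂m|
      ≤ ε * (A + B) := fun ε hε => by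
    obtain ⟨U, hU, hU'⟩ := hS.exists_nhds_one_uniform hg
      (hS.isCompact_setMul (isCompact_singleton (x := S.inv x)) hfc.isCompact) hε
    obtain ⟨V, hV, hV'⟩ := hS.exists_nhds_one_uniform hf
      (hS.isCompact_setMul (isCompact_singleton (x := x)) hgc.isCompact) hε
    obtain ⟨k, hkc, hk0, hk, hks, hkpos⟩ := hS.exists_symm_bump hm (inter_mem hU hV)
    have e1 := hS.abs_integral_kernel_avg_sub_le hm hkc hk0 hk hf hfc hg hgc (ε := ε) (S.inv x)
      fun y hy u hu w hw => hU' u (by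
        simp only [ConvData.setMul, mem_iUnion]; exact ⟨_, rfl, y, hy, hu⟩) w (hks w hw).1
    have e2 := hS.abs_integral_kernel_avg_sub_le hm hkc hk0 hk hg hgc hf hfc (ε := ε) x
      fun y hy u hu w hw => hV' u (by
        simp only [ConvData.setMul, mem_iUnion]; exact ⟨_, rfl, y, hy, hu⟩) w (hks w hw).2
    have hker : ∀ y z, S.avg x (S.avg (S.inv y) k) z = S.avg (S.inv x) (S.avg (S.inv z) k) y :=
      fun y z => by
        rw [hS.avg_comm, hS.avg_comm k (S.inv x)]
        have h1 := hS.integral_comp_inv (S.avg x k) y (S.inv z)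
        rw [hS.inv_inv] at h1
        rw [ConvData.avg, ← h1, hS.comm]
        simp only [hS.avg_inv_symm hk]
        rfl
    have hswap : ∫ z, g z * (∫ y, f y * S.avg x (S.avg (S.inv y) k) z ∂m) ∂m
        = ∫ y, f y * (∫ z, g z * S.avg (S.inv x) (S.avg (S.inv z) k) y ∂m) ∂m := by
      simp only [hker, ← integral_const_mul]
      rw [integral_integral_swap_of_hasCompactSupport]
      · simp only [mul_left_comm]
      · simp_rw [hS.avg_comm k (S.inv x)]
        exact (hg.comp continuous_fst).mul ((hf.comp continuous_snd).mul
          ((hS.continuous_avg_uncurry (hS.avgBcf (S.inv x) k)).comp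
          ((hS.continuous_inv.comp continuous_fst).prodMk continuous_snd)))
      · refine HasCompactSupport.intro (hgc.isCompact.prod hfc.isCompact) fun q hq => ?_
        by_contra h
        exact hq ⟨subset_tsupport _ (left_ne_zero_of_mul h),
          subset_tsupport _ (left_ne_zero_of_mul (right_ne_zero_of_mul h))⟩
    rw [hswap] at e2
    set c := ∫ t, k t ∂m
    rw [abs_le] at e1 e2 ⊢
    constructor
    · refine le_of_mul_le_mul_left ?_ hkpos
      nlinarith [e1.1, e1.2, e2.1, e2.2]
    · refine le_of_mul_le_mul_left ?_ hkpos
      nlinarith [e1.1, e1.2, e2.1, e2.2]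
  have h0 : |∫ y, g y * S.avg x f y ∂m - ∫ y, f y * S.avg (S.inv x) g y ∂m| ≤ 0 := by
    refine le_of_forall_pos_le_add fun δ hδ => ?_
    refine (key (δ / (A + B + 1)) (by positivity)).trans ?_
    rw [zero_add, div_mul_eq_mul_div, div_le_iff₀ (by positivity)]
    nlinarith
  have h1 := abs_nonpos_iff.1 h0
  rw [sub_eq_zero] at h1
  rw [← h1]
  simp only [mul_comm]

end Haar

end IsCommHypergroup

/-! ### Bumps against measures of sets, and compactly supported densities. -/

theorem lintegral_ofReal_le_measure {X : Type*} [TopologicalSpace X] [MeasurableSpace X]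
    [OpensMeasurableSpace X] (μ : Measure X) {f : X → ℝ} {U : Set X}
    (hf1 : ∀ x, f x ≤ 1) (hfU : tsupport f ⊆ U) :
    ∫⁻ x, ENNReal.ofReal (f x) ∂μ ≤ μ U := by
  calc ∫⁻ x, ENNReal.ofReal (f x) ∂μ ≤ ∫⁻ x, (tsupport f).indicator 1 x ∂μ := by
        refine lintegral_mono fun x => ?_
        by_cases hx : x ∈ tsupport f
        · simp [hx, hf1 x]
        · simp [image_eq_zero_of_notMem_tsupport hx]
    _ = μ (tsupport f) := lintegral_indicator_one (isClosed_tsupport f).measurableSet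
    _ ≤ μ U := measure_mono hfU

theorem measure_le_lintegral_ofReal {X : Type*} [MeasurableSpace X]
    (μ : Measure X) {f : X → ℝ} {C : Set X} (hC : MeasurableSet C)
    (hf : ∀ x ∈ C, f x = 1) : μ C ≤ ∫⁻ x, ENNReal.ofReal (f x) ∂μ := by
  rw [← lintegral_indicator_one hC]
  refine lintegral_mono fun x => ?_
  by_cases hx : x ∈ C
  · simp [hx, hf x hx]
  · simp [hx]

/-- A compact `C ⊆ A` with `μ (A \ C)` small also has `ρ (A \ C)` small. Applied to `m` restricted
to the support of a density, it makes that density's measure inner regular. -/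
theorem MeasureTheory.Measure.InnerRegular.of_le_smul {X : Type*} [TopologicalSpace X] [T2Space X]
    [MeasurableSpace X] [BorelSpace X] {μ ρ : Measure X} [IsFiniteMeasure μ] [μ.InnerRegular]
    {c : ENNReal} (hc : c ≠ ⊤) (h : ρ ≤ c • μ) : ρ.InnerRegular := by
  refine ⟨fun A hA r hr => ?_⟩
  have hρ : ρ A ≠ ⊤ := ((h A).trans_lt (by
    simpa using ENNReal.mul_lt_top hc.lt_top (measure_lt_top μ A))).ne
  have hδ : ρ A - r ≠ 0 := (tsub_pos_of_lt hr).ne'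
  obtain ⟨δ, hδ0, hδc⟩ : ∃ δ : ENNReal, δ ≠ 0 ∧ c * δ < ρ A - r := by
    rcases eq_or_ne c 0 with rfl | hc0
    · exact ⟨1, one_ne_zero, by simpa using tsub_pos_of_lt hr⟩
    · refine ⟨(ρ A - r) / 2 / c, ?_, ?_⟩
      · simp [hδ, hc]
      · rw [ENNReal.mul_div_cancel hc0 hc]
        exact ENNReal.half_lt_self hδ (ne_top_of_le_ne_top hρ tsub_le_self)
  obtain ⟨C, hCA, hC, hlt⟩ := hA.exists_isCompact_sdiff_lt (μ := μ) (measure_ne_top μ A) hδ0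
  refine ⟨C, hCA, hC, ?_⟩
  have h1 : ρ (A \ C) < ρ A - r := ((h _).trans (by
    simp only [Measure.smul_apply, smul_eq_mul]; gcongr)).trans_lt hδc
  by_contra hle
  rw [not_lt] at hle
  have : ρ A < ρ A := calc
    ρ A ≤ ρ C + ρ (A \ C) := by
      rw [← measure_inter_add_sdiff A hC.measurableSet]
      gcongr
      exact inter_subset_right
    _ < r + (ρ A - r) := ENNReal.add_lt_add_of_le_of_lt (ne_top_of_le_ne_top hr.ne_top hle) hle h1
    _ = ρ A := add_tsub_cancel_of_le hr.le
  exact lt_irrefl _ this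

section Density

variable {X : Type*} [TopologicalSpace X] [MeasurableSpace X] [BorelSpace X] {m : Measure X} [IsFiniteMeasureOnCompacts m]

theorem lintegral_withDensity_ofReal {v f : X → ℝ} (hv : Continuous v) (hvc : HasCompactSupport v)
    (hv0 : ∀ x, 0 ≤ v x) (hf : Continuous f) (hf0 : ∀ x, 0 ≤ f x) :
    ∫⁻ x, ENNReal.ofReal (f x) ∂m.withDensity (fun x => ENNReal.ofReal (v x))
      = ENNReal.ofReal (∫ x, v x * f x ∂m) := by
  rw [lintegral_withDensity_eq_lintegral_mul _ hv.measurable.ennreal_ofReal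
    hf.measurable.ennreal_ofReal, ofReal_integral_eq_lintegral_ofReal (f := fun x => v x * f x)
    ((hv.mul hf).integrable_of_hasCompactSupport hvc.mul_right)
    (.of_forall fun x => mul_nonneg (hv0 x) (hf0 x))]
  simp only [Pi.mul_apply, ENNReal.ofReal_mul (hv0 _)]

theorem withDensity_ofReal_univ {v : X → ℝ} (hv : Continuous v) (hvc : HasCompactSupport v)
    (hv0 : ∀ x, 0 ≤ v x) :
    m.withDensity (fun x => ENNReal.ofReal (v x)) univ = ENNReal.ofReal (∫ x, v x ∂m) := by
  rw [withDensity_apply _ MeasurableSet.univ, setLIntegral_univ,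
    ofReal_integral_eq_lintegral_ofReal (hv.integrable_of_hasCompactSupport hvc) (.of_forall hv0)]

theorem isFiniteMeasure_withDensity_ofReal_of_hasCompactSupport {v : X → ℝ} (hv : Continuous v)
    (hvc : HasCompactSupport v) (hv0 : ∀ x, 0 ≤ v x) :
    IsFiniteMeasure (m.withDensity (fun x => ENNReal.ofReal (v x))) :=
  ⟨by rw [withDensity_ofReal_univ hv hvc hv0]; exact ENNReal.ofReal_lt_top⟩

theorem innerRegular_withDensity_ofReal [T2Space X] [m.InnerRegular] {v : X → ℝ} (hv : Continuous v)
    (hvc : HasCompactSupport v) :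
    (m.withDensity (fun x => ENNReal.ofReal (v x))).InnerRegular := by
  obtain ⟨B, hB⟩ := hv.bounded_above_of_compact_support hvc
  have : Fact (m (tsupport v) < ⊤) := ⟨hvc.isCompact.measure_lt_top⟩
  refine Measure.InnerRegular.of_le_smul (μ := m.restrict (tsupport v)) (c := ENNReal.ofReal B)
    ENNReal.ofReal_ne_top ?_
  rw [Measure.le_iff]
  intro s hs
  rw [withDensity_apply _ hs, Measure.smul_apply, smul_eq_mul,
    Measure.restrict_apply hs, ← setLIntegral_const, ← lintegral_indicator hs,
    ← lintegral_indicator (hs.inter (isClosed_tsupport v).measurableSet)]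
  refine lintegral_mono fun x => ?_
  by_cases hx : x ∈ s
  · by_cases hxv : x ∈ tsupport v
    · simp only [hx, hxv, indicator_of_mem, mem_inter_iff, and_self]
      exact ENNReal.ofReal_le_ofReal ((le_abs_self _).trans (hB x))
    · simp [hx, image_eq_zero_of_notMem_tsupport hxv]
  · simp [hx]

end Density

/-! ### Translates of Borel functions and of null sets. -/

namespace IsCommHypergroup

variable {K : Type*} [TopologicalSpace K] [T2Space K] [LocallyCompactSpace K]
    [MeasurableSpace K] [BorelSpace K] {S : ConvData K} (hS : IsCommHypergroup S)

include hS

theorem lintegral_ofReal_eq_avg (f : K →ᵇ ℝ) (hf : ∀ t, 0 ≤ f t) (x y : K) :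
    ∫⁻ t, ENNReal.ofReal (f t) ∂S.conv x y = ENNReal.ofReal (S.avg x f y) := by
  have := hS.isProbability x y
  exact (ofReal_integral_eq_lintegral_ofReal (f.integrable _) (.of_forall hf)).symm

/-- By inner regularity, `ω(x, y)(U)` is the supremum of `T_x f(y)` over bumps `f` supported in `U`,
and each `T_x f` is continuous. -/
theorem lowerSemicontinuous_conv (x : K) {U : Set K} (hU : IsOpen U) :
    LowerSemicontinuous fun y => S.conv x y U := by
  intro y c hc
  have := hS.regular x y
  obtain ⟨C, hCU, hC, hcC⟩ := hU.exists_lt_isCompact hc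
  obtain ⟨f, -, hf1, hf0, hf1', hfs⟩ := exists_bump hC hU hCU
  have h1 := hcC.trans_le (measure_le_lintegral_ofReal (S.conv x y) hC.measurableSet hf1)
  rw [hS.lintegral_ofReal_eq_avg f hf0] at h1
  have hcont : Continuous fun y => ENNReal.ofReal (S.avg x f y) :=
    ENNReal.continuous_ofReal.comp (hS.continuous_avg x f)
  filter_upwards [hcont.continuousAt.eventually (lt_mem_nhds h1)] with z hz
  rw [← hS.lintegral_ofReal_eq_avg f hf0] at hz
  exact hz.trans_le (lintegral_ofReal_le_measure _ hf1' hfs)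

theorem measurable_conv (x : K) : Measurable (S.conv x) := by
  have := hS.isProbability x
  refine Measurable.measure_of_isPiSystem_of_isProbabilityMeasure
    BorelSpace.measurable_eq isPiSystem_isOpen
    fun U hU => ?_
  exact (hS.lowerSemicontinuous_conv x hU).measurable

section Haar

variable {m : Measure K} (hm : S.IsHaar m)

include hm

/-- The function `y ↦ ω(x, y)(U)` is a supremum of a possibly uncountable family `T_x f`, so
monotone convergence is unavailable. An upper semicontinuous minorant `h` with almost the same
integral replaces it: on the compact support of `v`, one `T_x f` dominates `h - ε`, and the adjoint
relation on `C_c` applies to this `f`. -/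
theorem bind_conv_isOpen_le (x : K) {v : K → ℝ} (hv : Continuous v) (hvc : HasCompactSupport v)
    (hv0 : ∀ t, 0 ≤ v t) {U : Set K} (hU : IsOpen U) :
    (m.withDensity fun y => ENNReal.ofReal (v y)).bind (S.conv x) U
      ≤ m.withDensity (fun y => ENNReal.ofReal (S.avg (S.inv x) v y)) U := by
  have := hm.finiteOnCompacts
  have := hm.innerRegular
  let vb : K →ᵇ ℝ := bcfOfCompactSupport v hv hvc
  set ρ := m.withDensity fun y => ENNReal.ofReal (v y) with hρ
  have : IsFiniteMeasure ρ := isFiniteMeasure_withDensity_ofReal_of_hasCompactSupport hv hvc hv0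
  have : ρ.InnerRegular := innerRegular_withDensity_ofReal hv hvc
  have hprob := hS.isProbability x
  have hreg := hS.regular x
  rw [Measure.bind_apply hU.measurableSet (hS.measurable_conv x).aemeasurable]
  have hg : ∀ y, ((S.conv x y U).toNNReal : ENNReal) = S.conv x y U := fun y =>
    ENNReal.coe_toNNReal (measure_ne_top _ _)
  -- The error has one `ε` from passing to `h` and `ε * ρ univ` from passing from `h` to `T_x f`.
  have key : ∀ ε : NNReal, 0 < ε → ∫⁻ y, S.conv x y U ∂ρ
      ≤ m.withDensity (fun y => ENNReal.ofReal (S.avg (S.inv x) v y)) U + ε * (ρ univ + 1) := by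
    intro ε hε
    obtain ⟨h, hhg, husc, hint⟩ := exists_upperSemicontinuous_le_lintegral_le (μ := ρ)
      (fun y => (S.conv x y U).toNNReal) (by
        simp only [hg]
        refine (lt_of_le_of_lt (lintegral_mono fun y => prob_le_one) ?_).ne
        simp [measure_lt_top]) (ε := ε) (by simpa using hε.ne')
    obtain ⟨f, hfc, hf0, hf1, hfU, hfh⟩ : ∃ f : K →ᵇ ℝ, HasCompactSupport f ∧ (∀ t, 0 ≤ f t) ∧
        (∀ t, f t ≤ 1) ∧ tsupport f ⊆ U ∧ ∀ y ∈ tsupport v, (h y : ℝ) ≤ S.avg x f y + ε := by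
      obtain ⟨C, hC, hCU, hCf⟩ : ∃ C, IsCompact C ∧ C ⊆ U ∧ ∀ f : K →ᵇ ℝ, (∀ t, 0 ≤ f t) →
          (∀ t ∈ C, f t = 1) → ∀ y ∈ tsupport v, (h y : ℝ) ≤ S.avg x f y + ε := by
        refine hvc.isCompact.induction_on (p := fun D => ∃ C, IsCompact C ∧ C ⊆ U ∧
          ∀ f : K →ᵇ ℝ, (∀ t, 0 ≤ f t) → (∀ t ∈ C, f t = 1) →
            ∀ y ∈ D, (h y : ℝ) ≤ S.avg x f y + ε) ⟨∅, isCompact_empty, by simp, by simp⟩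
          (fun s t hst ⟨C, hC, hCU, hh⟩ => ⟨C, hC, hCU, fun f h0 h1 y hy => hh f h0 h1 y (hst hy)⟩)
          ?_ fun y hy => ?_
        · rintro s t ⟨C, hC, hCU, hh⟩ ⟨C', hC', hCU', hh'⟩
          refine ⟨C ∪ C', hC.union hC', union_subset hCU hCU', fun f h0 h1 y hy => ?_⟩
          rcases hy with hy | hy
          · exact hh f h0 (fun t ht => h1 t (.inl ht)) y hy
          · exact hh' f h0 (fun t ht => h1 t (.inr ht)) y hy
        · obtain ⟨C, hCU, hC, hlt⟩ := hU.measurableSet.exists_isCompact_lt_add (μ := S.conv x y)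
            (measure_ne_top _ _) (ε := ε) (by simpa using hε.ne')
          obtain ⟨f, hfc, hfC, hf0, hf1, hfU⟩ := exists_bump hC hU hCU
          have hlt2 : (h y : ℝ) < S.avg x f y + ε := by
            have h1 := measure_le_lintegral_ofReal (S.conv x y) hC.measurableSet hfC
            rw [hS.lintegral_ofReal_eq_avg f hf0] at h1
            have h2 : (h y : ENNReal) < ENNReal.ofReal (S.avg x f y) + ε := by
              refine lt_of_le_of_lt ?_ (hlt.trans_le (add_le_add_left h1 _))
              rw [← hg]
              exact_mod_cast hhg y
            rw [← ENNReal.ofReal_coe_nnreal (p := ε), ← ENNReal.ofReal_add (S.avg_nonneg hf0 _ _)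
              ε.coe_nonneg, ← ENNReal.ofReal_coe_nnreal (p := h y)] at h2
            exact (ENNReal.ofReal_lt_ofReal_iff_of_nonneg (h y).coe_nonneg).1 h2
          obtain ⟨c, hc1, hc2⟩ := exists_between hlt2
          have hc0 : 0 ≤ c := (h y).coe_nonneg.trans hc1.le
          have n1 : ∀ᶠ z in 𝓝 y, (h z : ℝ) < c := by
            filter_upwards [husc y ⟨c, hc0⟩ hc1] with z hz using hz
          have n2 : ∀ᶠ z in 𝓝 y, c < S.avg x f z + ε :=
            (((hS.continuous_avg x f).add continuous_const).continuousAt).eventually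
              (lt_mem_nhds hc2)
          refine ⟨_, mem_nhdsWithin_of_mem_nhds (n1.and n2), tsupport f, hfc.isCompact, hfU,
            fun f' h0 h1 z hz => ?_⟩
          have hle : S.avg x f z ≤ S.avg x f' z := by
            refine integral_mono (f.integrable _) (f'.integrable _) fun t => ?_
            by_cases ht : t ∈ tsupport f
            · rw [h1 t ht]; exact hf1 t
            · rw [image_eq_zero_of_notMem_tsupport ht]; exact h0 t
          linarith [hz.1, hz.2]
      obtain ⟨f, hfc, hfC, hf0, hf1, hfU⟩ := exists_bump hC hU hCU
      exact ⟨f, hfc, hf0, hf1, hfU, hCf f hf0 hfC⟩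
    have hae : ∀ᵐ y ∂ρ, (h y : ENNReal) ≤ ENNReal.ofReal (S.avg x f y) + ε := by
      have : ∀ᵐ y ∂ρ, y ∈ tsupport v := by
        rw [hρ, ae_withDensity_iff hv.measurable.ennreal_ofReal]
        refine .of_forall fun y hy => ?_
        by_contra h
        simp [image_eq_zero_of_notMem_tsupport h] at hy
      filter_upwards [this] with y hy
      rw [← ENNReal.ofReal_coe_nnreal (p := ε), ← ENNReal.ofReal_add (S.avg_nonneg hf0 _ _)
        ε.coe_nonneg, ← ENNReal.ofReal_coe_nnreal (p := h y)]
      exact ENNReal.ofReal_le_ofReal (hfh y hy)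
    simp only [hg] at hint
    refine hint.trans ?_
    rw [mul_add, mul_one, ← add_assoc]
    gcongr
    refine (lintegral_mono_ae hae).trans ?_
    rw [lintegral_add_right _ measurable_const, lintegral_const]
    gcongr
    rw [lintegral_withDensity_ofReal hv hvc hv0 (hS.continuous_avg x f) (S.avg_nonneg hf0 x)]
    have hadj := hS.integral_avg_mul hm f.continuous hfc hv hvc x
    simp only [mul_comm (v _), hadj, mul_comm (f _)]
    have hTv : Continuous (S.avg (S.inv x) v) := hS.continuous_avg (S.inv x) vb
    rw [← lintegral_withDensity_ofReal hTv
      (hS.hasCompactSupport_avg hvc _) (S.avg_nonneg hv0 _) f.continuous hf0]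
    exact lintegral_ofReal_le_measure _ hf1 hfU
  refine ENNReal.le_of_forall_pos_le_add fun δ hδ _ => ?_
  have hR : ρ univ + 1 ≠ ⊤ := by simp
  have hR0 : (ρ univ + 1).toNNReal ≠ 0 := by
    rw [ne_eq, ENNReal.toNNReal_eq_zero_iff]; simp
  refine (key (δ / (ρ univ + 1).toNNReal) (by positivity)).trans ?_
  gcongr
  rw [ENNReal.coe_div hR0, ENNReal.coe_toNNReal hR, ENNReal.div_mul_cancel (by simp) hR]

/-- `(v m) * δ_x = (T_{x~} v) m` as Borel measures. -/
theorem bind_conv_eq (x : K) {v : K → ℝ} (hv : Continuous v) (hvc : HasCompactSupport v)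
    (hv0 : ∀ t, 0 ≤ v t) :
    (m.withDensity fun y => ENNReal.ofReal (v y)).bind (S.conv x)
      = m.withDensity (fun y => ENNReal.ofReal (S.avg (S.inv x) v y)) := by
  have := hm.finiteOnCompacts
  have := hm.innerRegular
  let vb : K →ᵇ ℝ := bcfOfCompactSupport v hv hvc
  have hprob := hS.isProbability x
  have hTv : Continuous (S.avg (S.inv x) v) := hS.continuous_avg (S.inv x) vb
  have hTc := hS.hasCompactSupport_avg hvc (S.inv x)
  have hT0 := S.avg_nonneg hv0 (S.inv x)
  have : IsFiniteMeasure (m.withDensity fun y => ENNReal.ofReal (S.avg (S.inv x) v y)) :=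
    isFiniteMeasure_withDensity_ofReal_of_hasCompactSupport hTv hTc hT0
  have : (m.withDensity fun y => ENNReal.ofReal (S.avg (S.inv x) v y)).InnerRegular :=
    innerRegular_withDensity_ofReal hTv hTc
  have huniv : (m.withDensity fun y => ENNReal.ofReal (v y)).bind (S.conv x) univ
      = m.withDensity (fun y => ENNReal.ofReal (S.avg (S.inv x) v y)) univ := by
    rw [Measure.bind_apply MeasurableSet.univ (hS.measurable_conv x).aemeasurable]
    simp only [measure_univ, lintegral_const, one_mul]
    rw [withDensity_ofReal_univ hv hvc hv0, withDensity_ofReal_univ hTv hTc hT0,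
      hm.integral_avg _ hv hvc]
  have : IsFiniteMeasure ((m.withDensity fun y => ENNReal.ofReal (v y)).bind (S.conv x)) :=
    ⟨by rw [huniv]; exact measure_lt_top _ _⟩
  -- Outer regularity of the right side extends the inequality from open sets to all sets; equal
  -- finite total masses turn it into equality.
  refine Measure.eq_of_le_of_measure_univ_eq (Measure.le_iff'.2 fun s => ?_) huniv
  rw [s.measure_eq_iInf_isOpen (m.withDensity _)]
  refine le_iInf₂ fun U hsU => le_iInf fun hU => ?_
  exact (measure_mono hsU).trans (hS.bind_conv_isOpen_le hm x hv hvc hv0 hU)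

/-- Translates of null sets are null. -/
theorem ae_conv_null (x : K) {N : Set K} (hN : m N = 0) : ∀ᵐ y ∂m, S.conv x y N = 0 := by
  have := hm.finiteOnCompacts
  have := hm.innerRegular
  wlog hNm : MeasurableSet N generalizing N
  · filter_upwards [this ((measure_toMeasurable N).trans hN) (measurableSet_toMeasurable m N)]
      with y hy using measure_mono_null (subset_toMeasurable m N) hy
  have hmeas : Measurable fun y => S.conv x y N :=
    (Measure.measurable_coe hNm).comp (hS.measurable_conv x)
  by_contra hne
  have hpos : 0 < m {y | S.conv x y N ≠ 0} := pos_iff_ne_zero.2 hne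
  -- Inner regularity of `m` reduces the claim to a compact set, where a density `v` equal to `1` on
  -- it makes `bind_conv_eq` applicable.
  obtain ⟨C, hCs, hC, hCpos⟩ :=
    (hmeas (measurableSet_singleton 0).compl : MeasurableSet {y | S.conv x y N ≠ 0}).exists_lt_isCompact
      hpos
  obtain ⟨v, hvc, hvC, hv0, -, -⟩ := exists_bump hC isOpen_univ (subset_univ _)
  have h := congrArg (fun μ => μ N) (hS.bind_conv_eq hm x v.continuous hvc hv0)
  simp only [Measure.bind_apply hNm (hS.measurable_conv x).aemeasurable] at h
  rw [withDensity_absolutelyContinuous _ _ hN, lintegral_withDensity_eq_lintegral_mul _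
    v.continuous.measurable.ennreal_ofReal hmeas, lintegral_eq_zero_iff
    (v.continuous.measurable.ennreal_ofReal.mul hmeas)] at h
  refine hCpos.ne' (measure_eq_zero_iff_ae_notMem.2 ?_)
  filter_upwards [h] with y hy hyC
  simp only [Pi.mul_apply, Pi.zero_apply, hvC y hyC, ENNReal.ofReal_one, one_mul] at hy
  exact hCs hyC hy

theorem avg_congr_ae {E : Type*} [NormedAddCommGroup E] [NormedSpace ℝ E] (x : K) {f g : K → E}
    (h : f =ᵐ[m] g) : S.avg x f =ᵐ[m] S.avg x g := by
  filter_upwards [hS.ae_conv_null hm x h] with y hy using integral_congr_ae hy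

/-- The adjoint relation for bounded Borel functions. -/
theorem integral_smul_avg {E : Type*} [NormedAddCommGroup E] [NormedSpace ℝ E] [CompleteSpace E]
    (x : K) {v : K → ℝ} (hv : Continuous v) (hvc : HasCompactSupport v) (hv0 : ∀ t, 0 ≤ v t)
    {φ : K → E} (hφ : AEStronglyMeasurable φ m) {M : ℝ} (hφM : ∀ᵐ y ∂m, ‖φ y‖ ≤ M) :
    ∫ y, v y • S.avg x φ y ∂m = ∫ y, S.avg (S.inv x) v y • φ y ∂m := by
  have := hm.finiteOnCompacts
  have hprob := hS.isProbability x
  let vb : K →ᵇ ℝ := bcfOfCompactSupport v hv hvc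
  have hTv : Continuous (S.avg (S.inv x) v) := hS.continuous_avg (S.inv x) vb
  have hTc := hS.hasCompactSupport_avg hvc (S.inv x)
  have hT0 := S.avg_nonneg hv0 (S.inv x)
  let κ : ProbabilityTheory.Kernel K K := ⟨S.conv x, hS.measurable_conv x⟩
  have : ProbabilityTheory.IsMarkovKernel κ := ⟨hprob⟩
  set ρ := m.withDensity fun y => ENNReal.ofReal (v y)
  have : IsFiniteMeasure (m.withDensity fun y => ENNReal.ofReal (S.avg (S.inv x) v y)) :=
    isFiniteMeasure_withDensity_ofReal_of_hasCompactSupport hTv hTc hT0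
  have hbind : ρ.bind κ = m.withDensity (fun y => ENNReal.ofReal (S.avg (S.inv x) v y)) :=
    hS.bind_conv_eq hm x hv hvc hv0
  have hac := withDensity_absolutelyContinuous m
    (fun y => ENNReal.ofReal (S.avg (S.inv x) v y))
  have hint : Integrable φ (ρ.bind κ) := by
    rw [hbind]
    exact Integrable.of_bound (hφ.mono_ac hac) M (hac.ae_le hφM)
  have h1 : ∫ z, φ z ∂ρ.bind κ = ∫ y, ∫ z, φ z ∂κ y ∂ρ := by
    rw [Measure.comp_eq_comp_const_apply] at hint ⊢
    rw [ProbabilityTheory.Kernel.integral_comp hint]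
    simp
  have e1 := integral_withDensity_eq_integral_toReal_smul (μ := m)
    hv.measurable.ennreal_ofReal (by simp) (S.avg x φ)
  have e2 := integral_withDensity_eq_integral_toReal_smul (μ := m)
    hTv.measurable.ennreal_ofReal (by simp) φ
  simp only [ENNReal.toReal_ofReal (hv0 _)] at e1
  simp only [ENNReal.toReal_ofReal (hT0 _)] at e2
  rw [← e1, ← e2, ← hbind, h1]
  rfl

/-- `x ↦ T_x v` is continuous for the `L¹` distance. -/
theorem tendsto_integral_abs_avg_sub {v : K → ℝ} (hv : Continuous v) (hvc : HasCompactSupport v)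
    (x : K) : Tendsto (fun z => ∫ y, |S.avg z v y - S.avg x v y| ∂m) (𝓝 x) (𝓝 0) := by
  have := hm.finiteOnCompacts
  let vb : K →ᵇ ℝ := bcfOfCompactSupport v hv hvc
  obtain ⟨D, hD, hDx⟩ := exists_compact_mem_nhds x
  have hx : x ∈ D := mem_of_mem_nhds hDx
  have hc : Continuous fun q : K × K => |S.avg q.1 v q.2 - S.avg x v q.2| :=
    ((hS.continuous_avg_uncurry vb).sub ((hS.continuous_avg x vb).comp continuous_snd)).abs
  -- For `z` in the compact neighbourhood `D` all integrands live on the one compact set `D~ · supp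
  -- v`.
  have := continuousOn_integral_of_compact_support (μ := m) (s := D)
    (f := fun z y => |S.avg z v y - S.avg x v y|)
    (hS.isCompact_setMul (hD.image hS.continuous_inv) hvc.isCompact) hc.continuousOn
    fun z y hz hy => by
      have h1 : S.avg z v y = 0 := by
        by_contra h; exact hy (hS.mem_setMul_of_avg_ne_zero hz h)
      have h2 : S.avg x v y = 0 := by
        by_contra h; exact hy (hS.mem_setMul_of_avg_ne_zero hx h)
      simp [h1, h2]
  have h := (this.continuousAt hDx).tendsto
  simpa using h

end Haar

end IsCommHypergroup

/-! ### Cosets and the quotient hypergroup. -/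

theorem MeasureTheory.Measure.support_map_of_isCompact {X Y : Type*} [TopologicalSpace X]
    [MeasurableSpace X] [BorelSpace X] [TopologicalSpace Y] [T2Space Y] [MeasurableSpace Y]
    [BorelSpace Y] {μ : Measure X} [μ.Regular] (hμ : IsCompact μ.support) {p : X → Y}
    (hp : Continuous p) : (μ.map p).support = p '' μ.support := by
  refine Subset.antisymm ?_ ?_
  · refine Measure.support_subset_of_isClosed (hμ.image hp).isClosed ?_
    rw [mem_ae_iff, Measure.map_apply hp.measurable (hμ.image hp).isClosed.measurableSet.compl]
    refine measure_mono_null (fun x hx hx' => hx (mem_image_of_mem p hx'))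
      (Measure.measure_compl_support_of_regular (μ := μ))
  · rintro _ ⟨x, hx, rfl⟩
    rw [Measure.mem_support_iff_forall] at hx ⊢
    intro U hU
    exact (hx _ (hp.continuousAt.preimage_mem_nhds hU)).trans_le
      (Measure.le_map_apply hp.aemeasurable U)

namespace ConvData

variable {K : Type*} [TopologicalSpace K] [MeasurableSpace K] {S : ConvData K} {H : Set K}

theorem mem_coset_iff {x y : K} : x ∈ S.coset H y ↔ ∃ h ∈ H, x ∈ (S.conv y h).support := by
  simp [ConvData.coset, ConvData.setMul]

theorem IsSubhypergroup.inv_mem (hH : S.IsSubhypergroup H) {h : K} (hh : h ∈ H) :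
    S.inv h ∈ H := by
  rw [← hH.inv_eq]
  exact mem_image_of_mem _ hh

theorem IsSubhypergroup.mem_of_mem_support (hH : S.IsSubhypergroup H) {h k z : K} (hh : h ∈ H)
    (hk : k ∈ H) (hz : z ∈ (S.conv h k).support) : z ∈ H := by
  rw [← hH.mul_eq]
  simp only [ConvData.setMul, mem_iUnion]
  exact ⟨h, hh, k, hk, hz⟩

theorem isSubhypergroup_of_or (hH : S.IsSubgroup H ∨ (S.IsSubhypergroup H ∧ IsCompact H)) :
    S.IsSubhypergroup H := by
  rcases hH with h | h
  · exact h.toIsSubhypergroup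
  · exact h.1

end ConvData

open ConvData (mem_coset_iff isSubhypergroup_of_or)

namespace IsCommHypergroup

variable {K : Type*} [TopologicalSpace K] [T2Space K] [LocallyCompactSpace K]
    [MeasurableSpace K] [BorelSpace K] {S : ConvData K} (hS : IsCommHypergroup S)
    {H : Set K}

include hS

theorem mem_coset_iff_inter {x y : K} :
    x ∈ S.coset H y ↔ ((S.conv x (S.inv y)).support ∩ H).Nonempty := by
  rw [mem_coset_iff]
  constructor
  · rintro ⟨h, hh, hx⟩
    rw [hS.comm] at hx
    exact ⟨h, hS.mem_support_reverse hx, hh⟩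
  · rintro ⟨h, hx, hh⟩
    rw [← hS.mem_support_reverse_iff, hS.comm] at hx
    exact ⟨h, hh, hx⟩

section Subhypergroup

variable (hH : S.IsSubhypergroup H)

include hH

theorem one_mem : S.one ∈ H := by
  obtain ⟨h, hh⟩ := hH.nonempty
  exact hH.mem_of_mem_support hh (hH.inv_mem hh)
    ((hS.one_mem_support _ _).2 (hS.inv_inv h).symm)

theorem self_mem_coset (x : K) : x ∈ S.coset H x :=
  mem_coset_iff.2 ⟨_, hS.one_mem hH, by rw [hS.support_conv_one]; rfl⟩

theorem coset_subset {x y : K} (h : x ∈ S.coset H y) : S.coset H x ⊆ S.coset H y := by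
  intro z hz
  rw [mem_coset_iff] at h hz ⊢
  obtain ⟨a, ha, hx⟩ := h
  obtain ⟨b, hb, hz⟩ := hz
  obtain ⟨w, hw, hzw⟩ := hS.exists_mem_support_assoc hx hz
  exact ⟨w, hH.mem_of_mem_support ha hb hw, hzw⟩

theorem mem_coset_symm {x y : K} (h : x ∈ S.coset H y) : y ∈ S.coset H x := by
  rw [mem_coset_iff] at h ⊢
  obtain ⟨a, ha, hx⟩ := h
  exact ⟨S.inv a, hH.inv_mem ha, hS.mem_support_reverse hx⟩

theorem coset_eq_iff {x y : K} : S.coset H x = S.coset H y ↔ x ∈ S.coset H y :=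
  ⟨fun h => h ▸ hS.self_mem_coset hH x, fun h => Subset.antisymm (hS.coset_subset hH h)
    (hS.coset_subset hH (hS.mem_coset_symm hH h))⟩

theorem proj_eq_iff {x y : K} : S.proj H x = S.proj H y ↔ x ∈ S.coset H y := by
  rw [← hS.coset_eq_iff hH]
  exact Quotient.eq

theorem proj_inv_eq {x y : K} (h : S.proj H x = S.proj H y) :
    S.proj H (S.inv x) = S.proj H (S.inv y) := by
  rw [hS.proj_eq_iff hH, mem_coset_iff] at h ⊢
  obtain ⟨a, ha, hx⟩ := h
  exact ⟨S.inv a, hH.inv_mem ha, hS.mem_support_inv hx⟩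

/-- Openness comes from the lower half of Vietoris continuity: if `supp ω(z, h)` meets `U`, so does
`supp ω(z', h)` for `z'` near `z`. -/
theorem isOpenQuotientMap_proj : IsOpenQuotientMap (S.proj H) := by
  refine ⟨Quotient.mk_surjective, S.continuous_proj H, fun U hU => ?_⟩
  change IsOpen (S.proj H ⁻¹' (S.proj H '' U))
  rw [isOpen_iff_mem_nhds]
  rintro z ⟨u, hu, huz⟩
  rw [hS.proj_eq_iff hH, mem_coset_iff] at huz
  obtain ⟨h, hh, huz⟩ := huz
  have hopen := (hS.isOpen_support_inter hU).preimage (Continuous.prodMk_left h)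
  filter_upwards [hopen.mem_nhds (show ((S.conv z h).support ∩ U).Nonempty from ⟨u, huz, hu⟩)]
    with z' hz'
  obtain ⟨u', hu', hu'U⟩ := hz'
  exact ⟨u', hu'U, (hS.proj_eq_iff hH).2 (mem_coset_iff.2 ⟨h, hh, hu'⟩)⟩

/-- For an open quotient map it suffices that the relation is closed. Its complement is `supp ω(x,
y~) ⊆ Hᶜ`, open by the upper half of Vietoris continuity. -/
theorem t2Space_quot : T2Space (S.QuotSpace H) := by
  rw [t2Space_iff_of_isOpenQuotientMap (hS.isOpenQuotientMap_proj hH), ← isOpen_compl_iff]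
  convert (hS.isOpen_support_subset hH.isClosed.isOpen_compl).preimage
    (continuous_id.prodMap hS.continuous_inv) using 1
  ext q
  simp only [mem_compl_iff, mem_ofPred_eq, hS.proj_eq_iff hH, hS.mem_coset_iff_inter,
    not_nonempty_iff_eq_empty, mem_preimage, Prod.map_fst, Prod.map_snd, id_eq,
    ← disjoint_iff_inter_eq_empty, subset_compl_iff_disjoint_right]

theorem locallyCompactSpace_quot : LocallyCompactSpace (S.QuotSpace H) :=
  (hS.isOpenQuotientMap_proj hH).locallyCompactSpace

theorem avg_comp_proj {E : Type*} [NormedAddCommGroup E] [NormedSpace ℝ E] [CompleteSpace E]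
    (f : S.QuotSpace H → E) {h : K} (hh : h ∈ H) (x : K) :
    S.avg h (fun t => f (S.proj H t)) x = f (S.proj H x) := by
  have := hS.isProbability h x
  have := hS.regular h x
  refine integral_eq_of_eqOn_support fun t ht => ?_
  rw [hS.comm] at ht
  rw [(hS.proj_eq_iff hH).2 (mem_coset_iff.2 ⟨h, hh, ht⟩)]

end Subhypergroup

section Quotient

variable (hH : S.IsSubgroup H ∨ (S.IsSubhypergroup H ∧ IsCompact H))

/-- Since `ω(h~, h)` is a point measure whose support contains `e`, `h` is invertible. For `a, b ∈
supp ω(y, h)`, reversing `b` and using associativity puts `a` in `supp ω(b, e) = {b}`. -/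
theorem support_subsingleton_of_isSubgroup (hH : S.IsSubgroup H) {h : K} (hh : h ∈ H) (y : K) :
    (S.conv y h).support.Subsingleton := by
  intro a ha b hb
  have hh' := hH.toIsSubhypergroup.inv_mem hh
  obtain ⟨z, -, hz⟩ := hH.conv_eq_dirac _ hh' _ hh
  have hsub : (S.conv (S.inv h) h).support ⊆ {z} := by
    apply Measure.support_subset_of_isClosed isClosed_singleton
    rw [hz, mem_ae_iff, Measure.dirac_apply' _ (isClosed_singleton.measurableSet.compl)]
    simp
  have h1 : S.one ∈ (S.conv (S.inv h) h).support := (hS.one_mem_support _ _).2 rfl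
  obtain ⟨w, hw, haw⟩ := hS.exists_mem_support_assoc (hS.mem_support_reverse hb) ha
  rw [(hsub hw).trans (hsub h1).symm, hS.support_conv_one] at haw
  exact haw

include hH

/-- A bounded continuous function that is invariant under `H` is constant on cosets. -/
theorem eq_of_proj_eq_of_avg_eq (G : K →ᵇ ℝ) (hG : ∀ h ∈ H, ∀ x, S.avg h G x = G x) {x y : K}
    (hxy : S.proj H x = S.proj H y) : G x = G y := by
  have hH' := isSubhypergroup_of_or hH
  rw [hS.proj_eq_iff hH'] at hxy
  rcases hH with hg | ⟨-, hc⟩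
  · obtain ⟨h, hh, hx⟩ := mem_coset_iff.1 hxy
    have := hS.isProbability y h
    have := hS.regular y h
    rw [← hG h hh y, hS.avg_swap]
    exact (integral_eq_of_eqOn_support fun t ht => by
      rw [hS.support_subsingleton_of_isSubgroup hg hh y ht hx]).symm
  -- Maximum principle on the compact coset: the maximum `G z` is the `ω(z, h)`-mean of `G` for each
  -- `h ∈ H`, so `G = G z` on every `supp ω(z, h)`, and these cover `zH = yH`.
  · obtain ⟨z, hz, hmax⟩ := (hS.isCompact_setMul isCompact_singleton hc :
      IsCompact (S.coset H y)).exists_isMaxOn ⟨y, hS.self_mem_coset hH' y⟩ G.continuous.continuousOn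
    have hzy := (hS.coset_eq_iff hH').2 hz
    have key : ∀ t ∈ S.coset H y, G t = G z := fun t ht => by
      refine le_antisymm (hmax ht) (not_lt.1 fun hlt => ?_)
      rw [← hzy, mem_coset_iff] at ht
      obtain ⟨h, hh, ht⟩ := ht
      have := hS.isProbability z h
      have := hS.regular z h
      let f : K →ᵇ ℝ := (BoundedContinuousFunction.const K (G z) - G) ⊔ 0
      have hpos := integral_pos_of_mem_support f (fun t => le_sup_right) ht
        (lt_sup_iff.2 (.inl (sub_pos.2 hlt)))
      have hf : ∫ t, f t ∂S.conv z h = ∫ t, (G z - G t) ∂S.conv z h := by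
        refine integral_congr_support fun s hs => ?_
        refine sup_eq_left.2 (sub_nonneg.2 (hmax ?_))
        change s ∈ S.coset H y
        rw [← hzy]
        exact mem_coset_iff.2 ⟨h, hh, hs⟩
      have hGz : ∫ t, G t ∂S.conv z h = G z := by
        have := hG h hh z
        rwa [hS.avg_swap] at this
      rw [hf, integral_sub (integrable_const _) (G.integrable _), hGz] at hpos
      simp at hpos
    rw [key x hxy, key y (hS.self_mem_coset hH' y)]

/-- The function `f ∘ p` is `H`-invariant, and by commutativity so is each of its translates. Hence
these are constant on cosets, and the two arguments may be changed one at a time. -/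
theorem integral_comp_proj_congr (f : S.QuotSpace H →ᵇ ℝ) {x x' y y' : K}
    (hx : S.proj H x = S.proj H x') (hy : S.proj H y = S.proj H y') :
    ∫ t, f (S.proj H t) ∂S.conv x y = ∫ t, f (S.proj H t) ∂S.conv x' y' := by
  have hH' := isSubhypergroup_of_or hH
  let F : K →ᵇ ℝ := f.compContinuous ⟨S.proj H, S.continuous_proj H⟩
  have key : ∀ z, ∀ {a b}, S.proj H a = S.proj H b → S.avg z F a = S.avg z F b := fun z a b hab =>
    hS.eq_of_proj_eq_of_avg_eq hH (hS.avgBcf z F) (fun h hh t => by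
      rw [hS.coe_avgBcf, hS.avg_comm]
      congr 1
      ext s
      exact hS.avg_comp_proj hH' f hh s) hab
  calc S.avg x F y = S.avg x F y' := key x hy
    _ = S.avg y' F x := hS.avg_swap _ _ _
    _ = S.avg y' F x' := key y' hx
    _ = S.avg x' F y' := hS.avg_swap _ _ _

theorem regular_map_proj (x y : K) : ((S.conv x y).map (S.proj H)).Regular := by
  have := hS.t2Space_quot (isSubhypergroup_of_or hH)
  have := hS.isProbability x y
  have := hS.regular x y
  have := Measure.InnerRegular.map_of_continuous (μ := S.conv x y) (S.continuous_proj H)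
  have := Measure.isProbabilityMeasure_map (μ := S.conv x y) (S.continuous_proj H).aemeasurable
  infer_instance

theorem map_proj_congr {x x' y y' : K}
    (hx : S.proj H x = S.proj H x') (hy : S.proj H y = S.proj H y') :
    (S.conv x y).map (S.proj H) = (S.conv x' y').map (S.proj H) := by
  have := hS.t2Space_quot (isSubhypergroup_of_or hH)
  have := hS.locallyCompactSpace_quot (isSubhypergroup_of_or hH)
  have := hS.regular_map_proj hH
  have := hS.isProbability
  have hp := (S.continuous_proj H).aemeasurable (μ := S.conv x y)
  have hp' := (S.continuous_proj H).aemeasurable (μ := S.conv x' y')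
  refine Measure.ext_of_integral_eq_on_compactlySupported fun f => ?_
  have hf : Continuous f := f.continuous
  rw [integral_map hp hf.aestronglyMeasurable, integral_map hp' hf.aestronglyMeasurable]
  exact hS.integral_comp_proj_congr hH (bcfOfCompactSupport f hf f.hasCompactSupport)
    hx hy

theorem quot_conv (x y : K) :
    (S.quot H).conv (S.proj H x) (S.proj H y) = (S.conv x y).map (S.proj H) :=
  hS.map_proj_congr hH (S.proj_rep H _) (S.proj_rep H _)

theorem quot_inv (x : K) : (S.quot H).inv (S.proj H x) = S.proj H (S.inv x) :=
  hS.proj_inv_eq (isSubhypergroup_of_or hH) (S.proj_rep H _)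

theorem integral_quot_conv {E : Type*} [NormedAddCommGroup E] [NormedSpace ℝ E]
    {f : S.QuotSpace H → E} (x y : K)
    (hf : AEStronglyMeasurable f ((S.quot H).conv (S.proj H x) (S.proj H y))) :
    ∫ t, f t ∂(S.quot H).conv (S.proj H x) (S.proj H y) = ∫ t, f (S.proj H t) ∂S.conv x y := by
  rw [hS.quot_conv hH] at hf ⊢
  exact integral_map (S.continuous_proj H).aemeasurable hf

theorem integral_quot_conv_bcf (f : S.QuotSpace H →ᵇ ℝ) (x y : K) :
    ∫ t, f t ∂(S.quot H).conv (S.proj H x) (S.proj H y) = ∫ t, f (S.proj H t) ∂S.conv x y :=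
  hS.integral_quot_conv hH x y f.continuous.aestronglyMeasurable

theorem support_quot_conv (x y : K) :
    ((S.quot H).conv (S.proj H x) (S.proj H y)).support = S.proj H '' (S.conv x y).support := by
  have := hS.t2Space_quot (isSubhypergroup_of_or hH)
  have := hS.regular x y
  rw [hS.quot_conv hH]
  exact Measure.support_map_of_isCompact (hS.isCompact_support x y) (S.continuous_proj H)

theorem continuous_quot_conv (f : S.QuotSpace H →ᵇ ℝ) :
    Continuous fun q : S.QuotSpace H × S.QuotSpace H => ∫ t, f t ∂(S.quot H).conv q.1 q.2 := by
  have hq := hS.isOpenQuotientMap_proj (isSubhypergroup_of_or hH)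
  rw [← (hq.prodMap hq).continuous_comp_iff]
  have : (fun q : S.QuotSpace H × S.QuotSpace H => ∫ t, f t ∂(S.quot H).conv q.1 q.2) ∘
      Prod.map (S.proj H) (S.proj H) = fun q : K × K => ∫ t, f (S.proj H t) ∂S.conv q.1 q.2 :=
    funext fun q => hS.integral_quot_conv_bcf hH f q.1 q.2
  rw [this]
  exact hS.continuous_conv (f.compContinuous ⟨S.proj H, S.continuous_proj H⟩)

/-- The quotient of a commutative hypergroup by a subgroup or a compact subhypergroup is a
commutative hypergroup. -/
theorem isCommHypergroup_quot [T2Space (S.QuotSpace H)] [LocallyCompactSpace (S.QuotSpace H)] :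
    IsCommHypergroup (S.quot H) := by
  have hH' := isSubhypergroup_of_or hH
  have hq := hS.isOpenQuotientMap_proj hH'
  have hinv : Continuous (S.quot H).inv := by
    rw [← hq.continuous_comp_iff]
    have : (S.quot H).inv ∘ S.proj H = S.proj H ∘ S.inv := funext (hS.quot_inv hH)
    rw [this]
    exact (S.continuous_proj H).comp hS.continuous_inv
  refine { isProbability := fun a b => ?_, regular := fun a b => ?_,
           isCompact_support := fun a b => ?_,
           continuous_conv := hS.continuous_quot_conv hH, continuous_support := ?_,
           assoc := fun f a b c => ?_, one_conv := fun a => ?_, comm := fun a b => ?_,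
           continuous_inv := hinv, inv_inv := fun a => ?_, map_inv := fun a b => ?_,
           one_mem_support := fun a b => ?_ }
  · have := hS.isProbability (S.rep H a) (S.rep H b)
    exact Measure.isProbabilityMeasure_map (S.continuous_proj H).aemeasurable
  · exact hS.regular_map_proj hH _ _
  · obtain ⟨x, rfl⟩ := hq.surjective a
    obtain ⟨y, rfl⟩ := hq.surjective b
    rw [hS.support_quot_conv hH]
    exact (hS.isCompact_support x y).image (S.continuous_proj H)
  · let _ := TopologicalSpace.vietoris K
    let _ := TopologicalSpace.vietoris (S.QuotSpace H)
    rw [← (hq.prodMap hq).continuous_comp_iff]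
    have : (fun q : S.QuotSpace H × S.QuotSpace H => ((S.quot H).conv q.1 q.2).support) ∘
        Prod.map (S.proj H) (S.proj H) =
        fun q : K × K => S.proj H '' (S.conv q.1 q.2).support :=
      funext fun q => hS.support_quot_conv hH q.1 q.2
    rw [this]
    exact (S.continuous_proj H).image_vietoris.comp hS.continuous_support
  · obtain ⟨x, rfl⟩ := hq.surjective a
    obtain ⟨y, rfl⟩ := hq.surjective b
    obtain ⟨z, rfl⟩ := hq.surjective c
    have hc := hS.continuous_quot_conv hH f
    have hc1 : Continuous fun u => ∫ t, f t ∂(S.quot H).conv u (S.proj H z) :=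
      hc.comp (Continuous.prodMk_left (S.proj H z))
    have hc2 : Continuous fun u => ∫ t, f t ∂(S.quot H).conv (S.proj H x) u :=
      hc.comp (Continuous.prodMk_right (S.proj H x))
    rw [hS.integral_quot_conv hH x y hc1.aestronglyMeasurable,
      hS.integral_quot_conv hH y z hc2.aestronglyMeasurable]
    simp only [hS.integral_quot_conv_bcf hH]
    exact hS.assoc (f.compContinuous ⟨S.proj H, S.continuous_proj H⟩) x y z
  · obtain ⟨x, rfl⟩ := hq.surjective a
    change (S.quot H).conv (S.proj H S.one) (S.proj H x) = _
    rw [hS.quot_conv hH, hS.one_conv, Measure.map_dirac' (S.continuous_proj H).measurable]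
  · change Measure.map _ _ = Measure.map _ _
    rw [hS.comm]
  · obtain ⟨x, rfl⟩ := hq.surjective a
    rw [hS.quot_inv hH, hS.quot_inv hH, hS.inv_inv]
  · obtain ⟨x, rfl⟩ := hq.surjective a
    obtain ⟨y, rfl⟩ := hq.surjective b
    rw [hS.quot_inv hH, hS.quot_inv hH, hS.quot_conv hH, hS.quot_conv hH, ← hS.map_inv,
      Measure.map_map hinv.measurable (S.continuous_proj H).measurable,
      Measure.map_map (S.continuous_proj H).measurable hS.continuous_inv.measurable]
    congr 1
    exact funext (hS.quot_inv hH)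
  · obtain ⟨x, rfl⟩ := hq.surjective a
    obtain ⟨y, rfl⟩ := hq.surjective b
    -- Both sides say that `supp ω(x, y)` meets `H`.
    rw [hS.support_quot_conv hH, hS.quot_inv hH, hS.proj_eq_iff hH', hS.mem_coset_iff_inter,
      hS.inv_inv]
    change S.proj H S.one ∈ _ ↔ _
    have h1 : ∀ t, S.proj H t = S.proj H S.one ↔ t ∈ H := fun t => by
      rw [hS.proj_eq_iff hH', mem_coset_iff]
      simp [hS.support_one_conv]
    constructor
    · rintro ⟨t, ht, h⟩
      exact ⟨t, ht, (h1 t).1 h⟩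
    · rintro ⟨t, ht, h⟩
      exact ⟨t, ht, (h1 t).2 h⟩

end Quotient

end IsCommHypergroup

/-! ### Non-singularity of the projection. -/

namespace IsCommHypergroup

variable {K : Type*} [TopologicalSpace K] [T2Space K] [LocallyCompactSpace K]
    [MeasurableSpace K] [BorelSpace K] {S : ConvData K} (hS : IsCommHypergroup S)
    {H : Set K} (hH : S.IsSubgroup H ∨ (S.IsSubhypergroup H ∧ IsCompact H))
    {m : Measure K} (hm : S.IsHaar m)
    {m' : Measure (S.QuotSpace H)} (hm' : (S.quot H).IsHaar m')

include hS hH hm hm'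

/-- Both bounds concern the double integral of `v(x) w(b) T_{xH} f(b)`. Moving the translation to
`w` on `K/H` gives the upper one, as `w ≤ 1`. At `b = yH`, moving `T_y` from `f ∘ p` to `v` on `K`
gives the lower one, as `T_{y~} v ≥ 1/2` and `f ∘ p = 1` on `C`. The use is that `∫ f dm'` is
bounded below independently of `f`. -/
theorem measure_mul_integral_le [T2Space (S.QuotSpace H)] [LocallyCompactSpace (S.QuotSpace H)]
    {C : Set K} (hC : IsCompact C)
    (v : K →ᵇ ℝ) (hvc : HasCompactSupport v) (hv0 : ∀ t, 0 ≤ v t)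
    (w : S.QuotSpace H →ᵇ ℝ) (hwc : HasCompactSupport w) (hw0 : ∀ t, 0 ≤ w t) (hw1 : ∀ t, w t ≤ 1)
    (hvw : ∀ b, w b ≠ 0 → ∃ y, S.proj H y = b ∧ ∀ x ∈ C, 1 / 2 ≤ S.avg (S.inv y) v x)
    (f : S.QuotSpace H →ᵇ ℝ) (hfc : HasCompactSupport f) (hf0 : ∀ t, 0 ≤ f t)
    (hf1 : ∀ x ∈ C, f (S.proj H x) = 1) :
    (m.real C / 2) * ∫ b, w b ∂m' ≤ (∫ x, v x ∂m) * ∫ b, f b ∂m' := by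
  have hQ := hS.isCommHypergroup_quot hH
  have := hm.finiteOnCompacts
  have := hm'.finiteOnCompacts
  have hquot : ∀ x y, (S.quot H).avg (S.proj H x) f (S.proj H y)
      = S.avg x (fun t => f (S.proj H t)) y := fun x y => hS.integral_quot_conv_bcf hH f x y
  have hcont : Continuous fun q : K × S.QuotSpace H =>
      v q.1 * (w q.2 * (S.quot H).avg (S.proj H q.1) f q.2) :=
    (v.continuous.comp continuous_fst).mul ((w.continuous.comp continuous_snd).mul
      ((hQ.continuous_avg_uncurry f).comp
        (((S.continuous_proj H).comp continuous_fst).prodMk continuous_snd)))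
  have hcs : HasCompactSupport fun q : K × S.QuotSpace H =>
      v q.1 * (w q.2 * (S.quot H).avg (S.proj H q.1) f q.2) := by
    refine HasCompactSupport.intro (hvc.isCompact.prod hwc.isCompact) fun q hq => ?_
    by_contra h
    exact hq ⟨subset_tsupport _ (left_ne_zero_of_mul h),
      subset_tsupport _ (left_ne_zero_of_mul (right_ne_zero_of_mul h))⟩
  have hswap := integral_integral_swap_of_hasCompactSupport (μ := m) (ν := m')
    (f := fun x b => v x * (w b * (S.quot H).avg (S.proj H x) f b)) hcont hcs
  have hlow : ∀ b, (m.real C / 2) * w b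
      ≤ ∫ x, v x * (w b * (S.quot H).avg (S.proj H x) f b) ∂m := fun b => by
    by_cases hb : w b = 0
    · simp [hb]
    obtain ⟨y, rfl, hy⟩ := hvw b hb
    have hadj := hS.integral_smul_avg hm y v.continuous hvc hv0
      (φ := fun t => f (S.proj H t)) (M := ‖f‖)
      (f.continuous.comp (S.continuous_proj H)).aestronglyMeasurable
      (.of_forall fun t => f.norm_coe_le_norm _)
    have e : ∫ x, v x * (w (S.proj H y) * (S.quot H).avg (S.proj H x) f (S.proj H y)) ∂m
        = w (S.proj H y) * ∫ x, v x • S.avg y (fun t => f (S.proj H t)) x ∂m := by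
      rw [← integral_const_mul]
      refine integral_congr_ae (.of_forall fun x => ?_)
      simp only [smul_eq_mul]
      rw [hquot, hS.avg_swap]
      ring
    rw [e, hadj, mul_comm]
    refine mul_le_mul_of_nonneg_left ?_ (hw0 _)
    have hi : Integrable (fun x => S.avg (S.inv y) v x • f (S.proj H x)) m :=
      ((hS.continuous_avg _ v).smul (f.continuous.comp
        (S.continuous_proj H))).integrable_of_hasCompactSupport
        (hS.hasCompactSupport_avg hvc _).smul_right
    calc m.real C / 2 = ∫ x in C, (1 / 2 : ℝ) ∂m := by simp; ring
      _ ≤ ∫ x in C, S.avg (S.inv y) v x • f (S.proj H x) ∂m := by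
          refine setIntegral_mono_on (integrableOn_const hC.measure_ne_top) hi.integrableOn
            hC.measurableSet fun x hx => ?_
          rw [hf1 x hx, smul_eq_mul, mul_one]
          exact hy x hx
      _ ≤ _ := setIntegral_le_integral hi (.of_forall fun x =>
          mul_nonneg (S.avg_nonneg hv0 _ _) (hf0 _))
  have hupp : ∀ x, ∫ b, v x * (w b * (S.quot H).avg (S.proj H x) f b) ∂m'
      ≤ v x * ∫ b, f b ∂m' := fun x => by
    rw [integral_const_mul]
    refine mul_le_mul_of_nonneg_left ?_ (hv0 x)
    have hadj := hQ.integral_avg_mul hm' f.continuous hfc w.continuous hwc (S.proj H x)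
    simp only [mul_comm (w _), hadj]
    refine integral_mono ((f.continuous.mul
      (hQ.continuous_avg _ w)).integrable_of_hasCompactSupport hfc.mul_right)
      (f.continuous.integrable_of_hasCompactSupport hfc) fun b => ?_
    refine mul_le_of_le_one_right (hf0 b) ?_
    have := hQ.isProbability ((S.quot H).inv (S.proj H x)) b
    refine (integral_mono (w.integrable _) (integrable_const (1 : ℝ)) hw1).trans (by simp)
  have hswapc := hcont.comp (continuous_swap (X := S.QuotSpace H) (Y := K))
  have c1 : Continuous fun x => ∫ b, v x * (w b * (S.quot H).avg (S.proj H x) f b) ∂m' := by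
    have := continuousOn_integral_of_compact_support (μ := m') (s := univ)
      (f := fun x b => v x * (w b * (S.quot H).avg (S.proj H x) f b)) hwc.isCompact
      hcont.continuousOn
      (fun u z _ hz => by simp only [image_eq_zero_of_notMem_tsupport hz, zero_mul, mul_zero])
    rwa [continuousOn_univ] at this
  have c2 : Continuous fun b => ∫ x, v x * (w b * (S.quot H).avg (S.proj H x) f b) ∂m := by
    have := continuousOn_integral_of_compact_support (μ := m) (s := univ)
      (f := fun b x => v x * (w b * (S.quot H).avg (S.proj H x) f b)) hvc.isCompact
      hswapc.continuousOn
      (fun u z _ hz => by simp only [image_eq_zero_of_notMem_tsupport hz, zero_mul])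
    rwa [continuousOn_univ] at this
  calc (m.real C / 2) * ∫ b, w b ∂m' = ∫ b, (m.real C / 2) * w b ∂m' :=
        (integral_const_mul _ _).symm
    _ ≤ ∫ b, ∫ x, v x * (w b * (S.quot H).avg (S.proj H x) f b) ∂m ∂m' := by
        refine integral_mono ((w.continuous.integrable_of_hasCompactSupport hwc).const_mul _)
          (c2.integrable_of_hasCompactSupport (HasCompactSupport.intro hwc.isCompact
            fun b hb => ?_)) hlow
        simp [image_eq_zero_of_notMem_tsupport hb]
    _ = ∫ x, ∫ b, v x * (w b * (S.quot H).avg (S.proj H x) f b) ∂m' ∂m := hswap.symm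
    _ ≤ ∫ x, v x * ∫ b, f b ∂m' ∂m := by
        refine integral_mono (c1.integrable_of_hasCompactSupport
          (HasCompactSupport.intro hvc.isCompact fun x hx => ?_))
          ((v.continuous.integrable_of_hasCompactSupport hvc).mul_const _) hupp
        simp [image_eq_zero_of_notMem_tsupport hx]
    _ = _ := integral_mul_const _ _

/-- The projection `K → K/H` is non-singular for the Haar measures. -/
theorem measure_preimage_proj_eq_zero {N : Set (S.QuotSpace H)} (hN : m' N = 0) :
    m (S.proj H ⁻¹' N) = 0 := by
  have hH' := isSubhypergroup_of_or hH
  have := hS.t2Space_quot hH'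
  have := hS.locallyCompactSpace_quot hH'
  have hQ := hS.isCommHypergroup_quot hH
  have := hm.finiteOnCompacts
  have := hm.innerRegular
  have := hm'.finiteOnCompacts
  have := hm'.innerRegular
  have := hQ.isOpenPosMeasure hm'
  have hp := S.continuous_proj H
  wlog hNm : MeasurableSet N generalizing N
  · exact measure_mono_null (preimage_mono (subset_toMeasurable m' N))
      (this ((measure_toMeasurable N).trans hN) (measurableSet_toMeasurable m' N))
  by_contra hne
  obtain ⟨C, hCN, hC, hCpos⟩ := (hp.measurable hNm).exists_lt_isCompact (pos_iff_ne_zero.2 hne)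
  have hN' : m' (S.proj H '' C) = 0 := measure_mono_null (image_subset_iff.2 hCN) hN
  have hN'c : IsCompact (S.proj H '' C) := hC.image hp
  obtain ⟨v, hvc, hvC, hv0, -, -⟩ := exists_bump hC isOpen_univ (subset_univ _)
  -- At `y = e` the translate is `v`, which is `1` on `C`; the tube lemma gives the bound `1/2` on
  -- `C` for all `y` in a neighbourhood `Y` of `e`.
  have hopen : IsOpen {q : K × K | 1 / 2 < S.avg (S.inv q.1) v q.2} :=
    isOpen_lt continuous_const ((hS.continuous_avg_uncurry v).comp
      ((hS.continuous_inv.comp continuous_fst).prodMk continuous_snd))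
  obtain ⟨Y, Z, hY, hZ, heY, hCZ, hYZ⟩ := generalized_tube_lemma
    (isCompact_singleton (x := S.one)) hC hopen (by
      rintro ⟨a, x⟩ ⟨rfl, hx⟩
      simp only [mem_ofPred_eq, hS.inv_one, hS.avg_one_left, hvC x hx]
      norm_num)
  obtain ⟨w, hwc, hw1, hw0, hw1', hws⟩ := exists_bump (isCompact_singleton (x := S.proj H S.one))
    ((hS.isOpenQuotientMap_proj hH').isOpenMap Y hY)
    (singleton_subset_iff.2 (mem_image_of_mem _ (heY rfl)))
  have hvw : ∀ b, w b ≠ 0 → ∃ y, S.proj H y = b ∧ ∀ x ∈ C, 1 / 2 ≤ S.avg (S.inv y) v x := by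
    intro b hb
    obtain ⟨y, hy, rfl⟩ := hws (subset_tsupport _ hb)
    exact ⟨y, rfl, fun x hx => (@hYZ (y, x) ⟨hy, hCZ hx⟩).le⟩
  have hwpos : 0 < ∫ b, w b ∂m' :=
    w.continuous.integral_pos_of_hasCompactSupport_nonneg_nonzero hwc hw0 (x := S.proj H S.one)
      (by rw [hw1 _ rfl]; exact one_ne_zero)
  have hCr : 0 < m.real C := ENNReal.toReal_pos hCpos.ne' hC.measure_ne_top
  set V := ∫ x, v x ∂m
  have hV : 0 ≤ V := integral_nonneg hv0
  have hprod : 0 < (m.real C / 2) * ∫ b, w b ∂m' := by positivity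
  set c := (m.real C / 2) * ∫ b, w b ∂m'
  have hε : 0 < c / (V + 1) := by positivity
  -- A bump `f` in `U` then has `V * ∫ f < c`, against the lower bound; the `+ 1` avoids a division
  -- by zero.
  obtain ⟨U, hNU, hU, hUlt⟩ := hN'c.exists_isOpen_lt_of_lt (μ := m') (ENNReal.ofReal (c / (V + 1)))
    (by rw [hN']; exact ENNReal.ofReal_pos.2 hε)
  obtain ⟨f, hfc, hfC, hf0, hf1, hfU⟩ := exists_bump hN'c hU hNU
  have hle := hS.measure_mul_integral_le hH hm hm' hC v hvc hv0 w hwc hw0 hw1' hvw f hfc hf0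
    fun x hx => hfC _ (mem_image_of_mem _ hx)
  have hint : ∫ b, f b ∂m' < c / (V + 1) := by
    have h1 := (lintegral_ofReal_le_measure m' hf1 hfU).trans_lt hUlt
    rw [← ofReal_integral_eq_lintegral_ofReal (f.continuous.integrable_of_hasCompactSupport hfc)
      (.of_forall hf0)] at h1
    exact (ENNReal.ofReal_lt_ofReal_iff hε).1 h1
  change c ≤ V * _ at hle
  rw [lt_div_iff₀ (by positivity)] at hint
  have : 0 ≤ ∫ b, f b ∂m' := integral_nonneg hf0
  nlinarith

end IsCommHypergroup

/-! ### Invariant functionals for commuting contractions. -/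

section InvariantFunctional

variable {E : Type*} [NormedAddCommGroup E] [NormedSpace ℂ E]

/-- Cesàro averages of contractions from a commuting family annihilate asymptotically the span of
the vectors `φ - T φ`. -/
theorem exists_contraction_norm_apply_le (𝒯 : Set (E →L[ℂ] E))
    (hcomm : ∀ T ∈ 𝒯, ∀ T' ∈ 𝒯, Commute T T') (hnorm : ∀ T ∈ 𝒯, ‖T‖ ≤ 1) {v : E}
    (hfix : ∀ T ∈ 𝒯, T v = v) {w : E}
    (hw : w ∈ Submodule.span ℂ {w | ∃ T ∈ 𝒯, ∃ φ, w = φ - T φ}) :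
    ∀ ε > 0, ∃ A ∈ Algebra.adjoin ℂ 𝒯, ‖A‖ ≤ 1 ∧ A v = v ∧ ‖A w‖ ≤ ε := by
  have hpow : ∀ T ∈ 𝒯, ∀ n : ℕ, ‖T ^ n‖ ≤ 1 ∧ (T ^ n) v = v := fun T hT n => by
    induction n with
    | zero => exact ⟨ContinuousLinearMap.norm_id_le, rfl⟩
    | succ n ih =>
      refine ⟨?_, ?_⟩
      · rw [pow_succ]
        exact (norm_mul_le _ _).trans (mul_le_one₀ ih.1 (norm_nonneg _) (hnorm T hT))
      · rw [pow_succ, mul_apply_eq_comp, hfix T hT, ih.2]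
  induction hw using Submodule.span_induction with
  | mem w hw =>
    obtain ⟨T, hT, φ, rfl⟩ := hw
    intro ε hε
    -- The Cesàro mean of `T` telescopes on `φ - T φ` to `(φ - T ^ n φ) / n`, of norm at most `2 *
    -- ‖φ‖ / n`.
    obtain ⟨n, hn⟩ := exists_nat_gt (2 * ‖φ‖ / ε)
    have hn0 : (0 : ℝ) < n := lt_of_le_of_lt (by positivity) hn
    have hnc : (n : ℂ) ≠ 0 := by exact_mod_cast hn0.ne'
    refine ⟨(n : ℂ)⁻¹ • ∑ i ∈ Finset.range n, T ^ i, ?_, ?_, ?_, ?_⟩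
    · exact Subalgebra.smul_mem _ (Subalgebra.sum_mem _ fun i _ =>
        Subalgebra.pow_mem _ (Algebra.subset_adjoin hT) i) _
    · rw [norm_smul, norm_inv, Complex.norm_natCast, inv_mul_le_iff₀ hn0, mul_one]
      refine (norm_sum_le _ _).trans ?_
      refine (Finset.sum_le_sum fun i _ => (hpow T hT i).1).trans (by simp)
    · simp only [smul_apply, sum_apply, (hpow T hT _).2,
        Finset.sum_const, Finset.card_range, ← Nat.cast_smul_eq_nsmul ℂ n v]
      rw [smul_smul, inv_mul_cancel₀ hnc, one_smul]
    · have h1 : (∑ i ∈ Finset.range n, T ^ i) (φ - T φ) = φ - (T ^ n) φ := by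
        have := congrArg (fun A : E →L[ℂ] E => A φ) (geom_sum_mul_neg T n)
        simpa using this
      rw [smul_apply, h1, norm_smul, norm_inv, Complex.norm_natCast,
        inv_mul_le_iff₀ hn0]
      have h2 : ‖φ - (T ^ n) φ‖ ≤ 2 * ‖φ‖ := by
        refine (norm_sub_le _ _).trans ?_
        have := (T ^ n).le_of_opNorm_le (hpow T hT n).1 φ
        linarith
      rw [div_lt_iff₀ hε] at hn
      linarith
  | zero => exact fun ε hε => ⟨1, Subalgebra.one_mem _, ContinuousLinearMap.norm_id_le, rfl,
      by simpa using hε.le⟩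
  | add w₁ w₂ _ _ ih₁ ih₂ =>
    intro ε hε
    obtain ⟨A, hA, hA1, hAv, hAw⟩ := ih₁ (ε / 2) (by positivity)
    obtain ⟨B, hB, hB1, hBv, hBw⟩ := ih₂ (ε / 2) (by positivity)
    -- Membership in the generated algebra is carried along for this: `A` and `B` commute, so `A *
    -- B` is small on both summands.
    have hAB : A * B = B * A := Algebra.commute_of_mem_adjoin_of_forall_mem_commute hB fun T hT =>
      (Algebra.commute_of_mem_adjoin_of_forall_mem_commute hA fun T' hT' => hcomm T hT T' hT').symm
    refine ⟨A * B, Subalgebra.mul_mem _ hA hB,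
      (norm_mul_le _ _).trans (mul_le_one₀ hA1 (norm_nonneg _) hB1), ?_, ?_⟩
    · rw [mul_apply_eq_comp, hBv, hAv]
    · have e1 : ‖(A * B) w₁‖ ≤ ε / 2 := by
        rw [hAB, mul_apply_eq_comp]
        refine (B.le_of_opNorm_le hB1 _).trans (by linarith)
      have e2 : ‖(A * B) w₂‖ ≤ ε / 2 := by
        rw [mul_apply_eq_comp]
        refine (A.le_of_opNorm_le hA1 _).trans (by linarith)
      rw [map_add]
      exact (norm_add_le _ _).trans (by linarith)
  | smul c w _ ih =>
    intro ε hε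
    obtain ⟨A, hA, hA1, hAv, hAw⟩ := ih (ε / (‖c‖ + 1)) (by positivity)
    refine ⟨A, hA, hA1, hAv, ?_⟩
    rw [map_smul, norm_smul]
    calc ‖c‖ * ‖A w‖ ≤ ‖c‖ * (ε / (‖c‖ + 1)) := by gcongr
      _ ≤ (‖c‖ + 1) * (ε / (‖c‖ + 1)) := by gcongr; linarith
      _ = ε := by field_simp

/-- A fixed vector of a commuting family of contractions is detected by an invariant functional. -/
theorem exists_invariant_functional (𝒯 : Set (E →L[ℂ] E))
    (hcomm : ∀ T ∈ 𝒯, ∀ T' ∈ 𝒯, Commute T T') (hnorm : ∀ T ∈ 𝒯, ‖T‖ ≤ 1) {v : E} (hv : v ≠ 0)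
    (hfix : ∀ T ∈ 𝒯, T v = v) :
    ∃ μ : E →L[ℂ] ℂ, μ v = 1 ∧ ∀ T ∈ 𝒯, ∀ φ, μ (T φ) = μ φ := by
  set N := Submodule.span ℂ {w | ∃ T ∈ 𝒯, ∃ φ, w = φ - T φ} with hN
  have hpos : 0 < ‖v‖ := norm_pos_iff.2 hv
  -- If `v` were in the closure of `N`, then `v = u + (v - u)` with `‖u‖ < ‖v‖ / 2` and `v - u ∈ N`;
  -- an averaging `A` fixing `v` and nearly killing `v - u` would give `‖v‖ < ‖v‖`.
  have hq : ‖(Submodule.Quotient.mk v : E ⧸ N)‖ ≠ 0 := fun h0 => by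
    obtain ⟨u, hu, hlt⟩ := QuotientAddGroup.norm_lt_iff.1
      (show ‖(Submodule.Quotient.mk v : E ⧸ N)‖ < ‖v‖ / 2 by rw [h0]; positivity)
    have hmem : v - u ∈ N := (Submodule.Quotient.eq N).1 hu.symm
    obtain ⟨A, -, hA1, hAv, hAw⟩ := exists_contraction_norm_apply_le 𝒯 hcomm hnorm hfix hmem
      (‖v‖ / 4) (by positivity)
    have h1 : ‖A u‖ ≤ 1 * ‖u‖ := A.le_of_opNorm_le hA1 u
    have h2 : v = A u + A (v - u) := by rw [← map_add]; simp [hAv]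
    have h3 := norm_add_le (A u) (A (v - u))
    rw [← h2] at h3
    linarith
  obtain ⟨g, -, hg⟩ := exists_dual_vector ℂ _ hq
  refine ⟨(‖(Submodule.Quotient.mk v : E ⧸ N)‖ : ℂ)⁻¹ • g.comp N.mkQL, ?_, fun T hT φ => ?_⟩
  · change (‖(Submodule.Quotient.mk v : E ⧸ N)‖ : ℂ)⁻¹ * g (Submodule.Quotient.mk v) = 1
    rw [hg]
    exact inv_mul_cancel₀ (by exact_mod_cast hq)
  · have : (Submodule.Quotient.mk (T φ) : E ⧸ N) = Submodule.Quotient.mk φ := by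
      refine ((Submodule.Quotient.eq N).2 ?_).symm
      exact Submodule.subset_span ⟨T, hT, φ, rfl⟩
    change _ * g (Submodule.Quotient.mk (T φ)) = _ * g (Submodule.Quotient.mk φ)
    rw [this]

end InvariantFunctional

/-! ### Maps between bounded continuous functions and `L^∞` spaces. -/

section LpTop

variable {X : Type*} [MeasurableSpace X] {m : Measure X}

theorem ae_norm_le_norm_of_Lp_top (f : Lp ℂ ⊤ m) : ∀ᵐ x ∂m, ‖f x‖ ≤ ‖f‖ := by
  have hfin := (Lp.memLp f).2.ne
  rw [eLpNorm_exponent_top] at hfin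
  filter_upwards [ae_le_eLpNormEssSup (f := f) (μ := m)] with x hx
  rw [Lp.norm_def, eLpNorm_exponent_top, ← toReal_enorm]
  exact ENNReal.toReal_mono hfin hx

theorem norm_toLp_top_le {f : X → ℂ} (hf : MemLp f ⊤ m) {C : ℝ} (hC : 0 ≤ C)
    (h : ∀ᵐ x ∂m, ‖f x‖ ≤ C) : ‖hf.toLp f‖ ≤ C := by
  rw [Lp.norm_toLp, eLpNorm_exponent_top]
  exact ENNReal.toReal_le_of_le_ofReal hC (eLpNormEssSup_le_of_ae_bound h)

theorem norm_integral_smul_le_of_Lp_top {w : X → ℝ} (hw : Integrable w m) (f : Lp ℂ ⊤ m) :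
    ‖∫ x, w x • f x ∂m‖ ≤ (∫ x, |w x| ∂m) * ‖f‖ := by
  rw [← integral_mul_const]
  refine norm_integral_le_of_norm_le (hw.abs.mul_const _) ?_
  filter_upwards [ae_norm_le_norm_of_Lp_top f] with x hx
  rw [norm_smul, Real.norm_eq_abs]
  gcongr

theorem integrable_smul_of_Lp_top {w : X → ℝ} (hw : Integrable w m) (f : Lp ℂ ⊤ m) :
    Integrable (fun x => w x • f x) m := by
  refine Integrable.mono' (hw.abs.mul_const ‖f‖)
    (hw.aestronglyMeasurable.smul (Lp.aestronglyMeasurable f)) ?_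
  filter_upwards [ae_norm_le_norm_of_Lp_top f] with x hx
  rw [norm_smul, Real.norm_eq_abs]
  gcongr

/-- Bounded continuous functions in `L^∞`. -/
def bcfToLpTop [TopologicalSpace X] [BorelSpace X] (m : Measure X) :
    (X →ᵇ ℂ) →L[ℂ] Lp ℂ ⊤ m :=
  LinearMap.mkContinuous
    { toFun := fun f => (memLp_top_of_bcf m f).toLp f
      map_add' := fun _ _ => rfl
      map_smul' := fun _ _ => rfl } 1 fun f => by
    rw [one_mul]
    exact norm_toLp_top_le (memLp_top_of_bcf m f) (norm_nonneg _) (.of_forall f.norm_coe_le_norm)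

theorem coeFn_bcfToLpTop [TopologicalSpace X] [BorelSpace X] (f : X →ᵇ ℂ) :
    bcfToLpTop m f =ᵐ[m] f :=
  (memLp_top_of_bcf m f).coeFn_toLp

theorem memLp_top_comp {Y : Type*} [MeasurableSpace Y] {m' : Measure Y} {p : X → Y}
    (hp : Measure.QuasiMeasurePreserving p m m') (f : Lp ℂ ⊤ m') : MemLp (f ∘ p) ⊤ m :=
  memLp_top_of_bound ((Lp.aestronglyMeasurable f).comp_quasiMeasurePreserving hp) ‖f‖
    (hp.ae (ae_norm_le_norm_of_Lp_top f))

/-- Composition with a non-singular map on `L^∞`. -/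
def compLpTop {Y : Type*} [MeasurableSpace Y] {m' : Measure Y} {p : X → Y}
    (hp : Measure.QuasiMeasurePreserving p m m') : Lp ℂ ⊤ m' →L[ℂ] Lp ℂ ⊤ m :=
  LinearMap.mkContinuous
    { toFun := fun f => (memLp_top_comp hp f).toLp (f ∘ p)
      map_add' := fun f g => by
        rw [← MemLp.toLp_add]
        exact MemLp.toLp_congr _ _ (hp.ae_eq_comp (Lp.coeFn_add f g))
      map_smul' := fun c f => by
        rw [RingHom.id_apply, ← MemLp.toLp_const_smul]
        exact MemLp.toLp_congr _ _ (hp.ae_eq_comp (Lp.coeFn_smul c f)) } 1 fun f => by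
    rw [one_mul]
    exact norm_toLp_top_le (memLp_top_comp hp f) (norm_nonneg _) (hp.ae (ae_norm_le_norm_of_Lp_top f))

theorem coeFn_compLpTop {Y : Type*} [MeasurableSpace Y] {m' : Measure Y} {p : X → Y}
    (hp : Measure.QuasiMeasurePreserving p m m') (f : Lp ℂ ⊤ m') :
    compLpTop hp f =ᵐ[m] f ∘ p :=
  (memLp_top_comp hp f).coeFn_toLp

end LpTop

/-! ### Translation operators and the smoothing of `L^∞` functions. -/

namespace IsCommHypergroup

variable {K : Type*} [TopologicalSpace K] [T2Space K] [LocallyCompactSpace K]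
    [MeasurableSpace K] [BorelSpace K] {S : ConvData K} (hS : IsCommHypergroup S)

/-- Translation as an operator on complex bounded continuous functions. -/
def transl (x : K) : (K →ᵇ ℂ) →L[ℂ] (K →ᵇ ℂ) :=
  LinearMap.mkContinuous
    { toFun := fun f => BoundedContinuousFunction.ofNormedAddCommGroup (S.avg x f)
        ((hS.continuous_integral_complex f).comp (Continuous.prodMk_right x)) ‖f‖ fun y => by
          have := hS.isProbability x y
          exact f.norm_integral_le_norm _
      map_add' := fun f g => by
        ext y
        have := hS.isProbability x y
        exact integral_add (f.integrable _) (g.integrable _)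
      map_smul' := fun c f => by
        ext y
        exact integral_const_mul c _ } 1 fun f => by
    rw [one_mul]
    refine (BoundedContinuousFunction.norm_le (norm_nonneg _)).2 fun y => ?_
    have := hS.isProbability x y
    exact f.norm_integral_le_norm _

include hS

theorem norm_transl_le (x : K) : ‖hS.transl x‖ ≤ 1 := LinearMap.mkContinuous_norm_le _ zero_le_one _

theorem transl_transl_apply (x y z : K) (f : K →ᵇ ℂ) :
    hS.transl x (hS.transl y f) z = ∫ w, S.avg w f z ∂S.conv x y := by
  rw [hS.comm x y]
  exact (hS.assoc_complex f y x z).symm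

theorem transl_comm (x y : K) : Commute (hS.transl x) (hS.transl y) := by
  refine ContinuousLinearMap.ext fun f => ?_
  ext z
  change hS.transl x (hS.transl y f) z = hS.transl y (hS.transl x f) z
  rw [hS.transl_transl_apply, hS.transl_transl_apply, hS.comm]

/-- If `x ↦ T_x Φ` is norm continuous, then `T_z (x ↦ μ(T_x Φ)) (x) = μ(T_z T_x Φ)`. -/
theorem integral_functional_transl (μ : (K →ᵇ ℂ) →L[ℂ] ℂ) {Φ : K →ᵇ ℂ}
    (hΦ : Continuous fun x => hS.transl x Φ) (z x : K) :
    ∫ w, μ (hS.transl w Φ) ∂S.conv z x = μ (hS.transl z (hS.transl x Φ)) := by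
  have := hS.isProbability z x
  have := hS.regular z x
  -- Norm continuity and compact support give a Bochner integral of functions, through which both
  -- `μ` and point evaluations pass.
  have hint : Integrable (fun w => hS.transl w Φ) (S.conv z x) :=
    integrable_of_isCompact_support (hS.isCompact_support z x) hΦ
  rw [μ.integral_comp_comm hint]
  congr 1
  ext y
  rw [hS.transl_transl_apply]
  exact ((BoundedContinuousFunction.evalCLM ℂ y).integral_comp_comm hint).symm

section Smear

variable {m : Measure K} (hm : S.IsHaar m) {v : K → ℝ} (hv : Continuous v)
  (hvc : HasCompactSupport v)

include hm hv hvc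

theorem integrable_avg (x : K) : Integrable (S.avg x v) m := by
  have := hm.finiteOnCompacts
  exact (hS.continuous_avg x (bcfOfCompactSupport v hv hvc)).integrable_of_hasCompactSupport
    (hS.hasCompactSupport_avg hvc x)

theorem integral_abs_avg_le (x : K) : ∫ y, |S.avg x v y| ∂m ≤ ∫ y, |v y| ∂m := by
  have habs : HasCompactSupport fun y => |v y| := hvc.comp_left abs_zero
  rw [← hm.integral_avg x hv.abs habs]
  refine integral_mono (hS.integrable_avg hm hv hvc x).abs
    (hS.integrable_avg hm hv.abs habs x) fun y => ?_
  exact abs_integral_le_integral_abs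

theorem continuous_integral_avg_inv_smul (f : Lp ℂ ⊤ m) :
    Continuous fun x => ∫ y, S.avg (S.inv x) v y • f y ∂m := by
  rw [continuous_iff_continuousAt]
  intro x
  have ht := ((hS.tendsto_integral_abs_avg_sub hm hv hvc (S.inv x)).comp
    hS.continuous_inv.continuousAt).mul_const ‖f‖
  rw [zero_mul] at ht
  refine tendsto_iff_norm_sub_tendsto_zero.2 (squeeze_zero (fun _ => norm_nonneg _)
    (fun z => ?_) ht)
  have i1 := hS.integrable_avg hm hv hvc (S.inv z)
  have i2 := hS.integrable_avg hm hv hvc (S.inv x)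
  rw [← integral_sub (integrable_smul_of_Lp_top i1 f) (integrable_smul_of_Lp_top i2 f)]
  simp only [← sub_smul]
  exact norm_integral_smul_le_of_Lp_top (i1.sub i2) f

/-- The operator `f ↦ (x ↦ ∫ f · T_{x~} v dm)` from `L^∞` to bounded continuous functions. -/
def smear : Lp ℂ ⊤ m →L[ℂ] (K →ᵇ ℂ) :=
  LinearMap.mkContinuous
    { toFun := fun f => BoundedContinuousFunction.ofNormedAddCommGroup
        (fun x => ∫ y, S.avg (S.inv x) v y • f y ∂m)
        (hS.continuous_integral_avg_inv_smul hm hv hvc f) ((∫ y, |v y| ∂m) * ‖f‖) fun x =>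
          (norm_integral_smul_le_of_Lp_top (hS.integrable_avg hm hv hvc _) f).trans
            (mul_le_mul_of_nonneg_right (hS.integral_abs_avg_le hm hv hvc _) (norm_nonneg _))
      map_add' := fun f g => by
        ext x
        have i := hS.integrable_avg hm hv hvc (S.inv x)
        change ∫ y, S.avg (S.inv x) v y • (f + g) y ∂m = ∫ y, S.avg (S.inv x) v y • f y ∂m
          + ∫ y, S.avg (S.inv x) v y • g y ∂m
        rw [← integral_add (integrable_smul_of_Lp_top i f) (integrable_smul_of_Lp_top i g)]
        refine integral_congr_ae ?_
        filter_upwards [Lp.coeFn_add f g] with y hy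
        rw [hy, Pi.add_apply, smul_add]
      map_smul' := fun c f => by
        ext x
        change ∫ y, S.avg (S.inv x) v y • (c • f) y ∂m
          = c * ∫ y, S.avg (S.inv x) v y • f y ∂m
        rw [← integral_const_mul]
        refine integral_congr_ae ?_
        filter_upwards [Lp.coeFn_smul c f] with y hy
        rw [hy, Pi.smul_apply, smul_eq_mul, mul_smul_comm] } (∫ y, |v y| ∂m) fun f =>
    (BoundedContinuousFunction.norm_le (mul_nonneg (integral_nonneg fun _ => abs_nonneg _)
      (norm_nonneg _))).2 fun _ =>
        (norm_integral_smul_le_of_Lp_top (hS.integrable_avg hm hv hvc _) f).trans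
          (mul_le_mul_of_nonneg_right (hS.integral_abs_avg_le hm hv hvc _) (norm_nonneg _))

theorem smear_apply (f : Lp ℂ ⊤ m) (x : K) :
    hS.smear hm hv hvc f x = ∫ y, S.avg (S.inv x) v y • f y ∂m := rfl

theorem transl_smear_apply (f : Lp ℂ ⊤ m) (z x : K) :
    hS.transl z (hS.smear hm hv hvc f) x
      = ∫ y, S.avg (S.inv z) (S.avg (S.inv x) v) y • f y ∂m := by
  have := hm.finiteOnCompacts
  have := hS.isProbability z x
  have := hS.regular z x
  let vb : K →ᵇ ℝ := bcfOfCompactSupport v hv hvc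
  obtain ⟨b, hbc, hb1, -, -, -⟩ := exists_bump (hS.isCompact_support z x) isOpen_univ
    (subset_univ _)
  have hcont : Continuous fun q : K × K => b q.1 * S.avg (S.inv q.1) v q.2 :=
    (b.continuous.comp continuous_fst).mul ((hS.continuous_avg_uncurry vb).comp
      ((hS.continuous_inv.comp continuous_fst).prodMk continuous_snd))
  have hswap := integral_integral_swap_smul (S.conv z x) (hS.isCompact_support z x) m
    (F := fun w y => b w * S.avg (S.inv w) v y) hcont
    (hS.isCompact_setMul ((hbc.isCompact.image hS.continuous_inv).image hS.continuous_inv)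
      hvc.isCompact)
    (fun w y hy => by
      by_contra h
      exact hy (hS.mem_setMul_of_avg_ne_zero
        (mem_image_of_mem _ (subset_tsupport _ (left_ne_zero_of_mul h)))
        (right_ne_zero_of_mul h)))
    (Lp.aestronglyMeasurable f) (ae_norm_le_norm_of_Lp_top f)
  calc ∫ w, (∫ y, S.avg (S.inv w) v y • f y ∂m) ∂S.conv z x
      = ∫ w, (∫ y, (b w * S.avg (S.inv w) v y) • f y ∂m) ∂S.conv z x :=
        integral_congr_support fun w hw => by simp only [hb1 w hw, one_mul]
    _ = ∫ y, (∫ w, b w * S.avg (S.inv w) v y ∂S.conv z x) • f y ∂m := hswap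
    _ = _ := by
        refine integral_congr_ae (.of_forall fun y => ?_)
        simp only
        congr 1
        rw [show S.avg (S.inv z) (S.avg (S.inv x) v) y = _ from
          hS.avg_avg vb (S.inv z) (S.inv x) y, ← hS.integral_comp_inv (fun w => S.avg w vb y)]
        exact integral_congr_support fun w hw => by rw [hb1 w hw, one_mul]; rfl

/-- The difference of two translates at `y` pairs `f` with `T_{y~}(T_{z~} v - T_{x~} v)`. As
`T_{y~}` does not increase the `L¹` norm, the bound is uniform in `y`. -/
theorem continuous_transl_smear (f : Lp ℂ ⊤ m) :
    Continuous fun z => hS.transl z (hS.smear hm hv hvc f) := by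
  let vb : K →ᵇ ℝ := bcfOfCompactSupport v hv hvc
  rw [continuous_iff_continuousAt]
  intro x
  have ht := ((hS.tendsto_integral_abs_avg_sub hm hv hvc (S.inv x)).comp
    hS.continuous_inv.continuousAt).mul_const ‖f‖
  rw [zero_mul] at ht
  refine tendsto_iff_norm_sub_tendsto_zero.2 (squeeze_zero (fun _ => norm_nonneg _)
    (fun z => ?_) ht)
  refine (BoundedContinuousFunction.norm_le (mul_nonneg (integral_nonneg fun _ => abs_nonneg _)
    (norm_nonneg _))).2 fun y => ?_
  have hc : ∀ a, Continuous (S.avg a v) := fun a => hS.continuous_avg a vb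
  have hcc : ∀ a, HasCompactSupport (S.avg a v) := fun a => hS.hasCompactSupport_avg hvc a
  have hd : Continuous fun t => S.avg (S.inv z) v t - S.avg (S.inv x) v t := (hc _).sub (hc _)
  have hdc : HasCompactSupport fun t => S.avg (S.inv z) v t - S.avg (S.inv x) v t :=
    (hcc _).sub (hcc _)
  have e : hS.transl z (hS.smear hm hv hvc f) y - hS.transl x (hS.smear hm hv hvc f) y
      = ∫ t, S.avg (S.inv y) (fun t => S.avg (S.inv z) v t - S.avg (S.inv x) v t) t • f t ∂m := by
    rw [hS.transl_smear_apply hm hv hvc, hS.transl_smear_apply hm hv hvc,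
      ← integral_sub
        (integrable_smul_of_Lp_top (hS.integrable_avg hm (hc _) (hcc _) _) f)
        (integrable_smul_of_Lp_top (hS.integrable_avg hm (hc _) (hcc _) _) f)]
    refine integral_congr_ae (.of_forall fun t => ?_)
    simp only [← sub_smul]
    congr 1
    rw [show S.avg (S.inv z) (S.avg (S.inv y) v) t = _ from hS.avg_comm vb _ _ _,
      show S.avg (S.inv x) (S.avg (S.inv y) v) t = _ from hS.avg_comm vb _ _ _]
    have := hS.isProbability (S.inv y) t
    exact (integral_sub ((hS.avgBcf (S.inv z) vb).integrable _)
      ((hS.avgBcf (S.inv x) vb).integrable _)).symm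
  rw [BoundedContinuousFunction.sub_apply, e]
  refine (norm_integral_smul_le_of_Lp_top (hS.integrable_avg hm hd hdc _) f).trans ?_
  exact mul_le_mul_of_nonneg_right (hS.integral_abs_avg_le hm hd hdc _) (norm_nonneg _)

theorem smear_eq_transl (hv0 : ∀ t, 0 ≤ v t) (z : K) {f g : Lp ℂ ⊤ m}
    (hg : g =ᵐ[m] S.translate z f) :
    hS.smear hm hv hvc g = hS.transl z (hS.smear hm hv hvc f) := by
  let vb : K →ᵇ ℝ := bcfOfCompactSupport v hv hvc
  ext x
  have hc : Continuous (S.avg (S.inv x) v) := hS.continuous_avg (S.inv x) vb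
  rw [hS.transl_smear_apply hm hv hvc, hS.smear_apply hm hv hvc,
    ← hS.integral_smul_avg hm z hc (hS.hasCompactSupport_avg hvc _) (S.avg_nonneg hv0 _)
      (Lp.aestronglyMeasurable f) (ae_norm_le_norm_of_Lp_top f)]
  refine integral_congr_ae ?_
  filter_upwards [hg] with y hy
  rw [hy]
  rfl

end Smear

end IsCommHypergroup

/-! ### Characters and the two implications. -/

namespace IsCommHypergroup

variable {K : Type*} [TopologicalSpace K] [T2Space K] [LocallyCompactSpace K]
    [MeasurableSpace K] [BorelSpace K] {S : ConvData K} (hS : IsCommHypergroup S)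

include hS

theorem _root_.ConvData.IsCharacter.map_one {α : K →ᵇ ℂ} (hα : S.IsCharacter α) :
    α S.one = 1 := by
  obtain ⟨x, hx⟩ : ∃ x, α x ≠ 0 := by
    by_contra! h
    exact hα.ne_zero (BoundedContinuousFunction.ext h)
  have h := hα.map_conv S.one x
  rw [hS.one_conv, integral_dirac] at h
  exact (mul_eq_right₀ hx).1 h.symm

theorem transl_character {α : K →ᵇ ℂ} (hα : S.IsCharacter α) (x : K) :
    hS.transl x α = α x • α := by
  ext y
  exact hα.map_conv x y

/-- Since `α(e) = 1`, a bump supported where `Re α > 1/2` works. -/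
theorem exists_bump_integral_smul_ne_zero {m : Measure K} (hm : S.IsHaar m) {α : K →ᵇ ℂ}
    (hα : S.IsCharacter α) :
    ∃ v : K →ᵇ ℝ, HasCompactSupport v ∧ (∀ t, 0 ≤ v t) ∧ ∫ y, v y • α y ∂m ≠ 0 := by
  have := hm.finiteOnCompacts
  have := hS.isOpenPosMeasure hm
  have hre : Continuous fun t => (α t).re := Complex.continuous_re.comp α.continuous
  obtain ⟨v, hvc, hv1, hv0, -, hvU⟩ := exists_bump (isCompact_singleton (x := S.one))
    (isOpen_lt continuous_const hre : IsOpen {t | 1 / 2 < (α t).re})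
    (singleton_subset_iff.2 (by
      rw [mem_ofPred_eq, hα.map_one hS]; norm_num))
  refine ⟨v, hvc, hv0, fun h0 => ?_⟩
  have hint : Integrable (fun y => v y • α y) m :=
    (v.continuous.smul α.continuous).integrable_of_hasCompactSupport hvc.smul_right
  have hvint := v.continuous.integrable_of_hasCompactSupport (μ := m) hvc
  have hpos : 0 < ∫ y, v y ∂m :=
    v.continuous.integral_pos_of_hasCompactSupport_nonneg_nonzero hvc hv0 (x := S.one)
      (by rw [hv1 _ rfl]; exact one_ne_zero)
  have h1 : ∫ y, v y * (α y).re ∂m = 0 := by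
    have := integral_re hint
    rw [h0] at this
    simpa using this
  have h2 : ∫ y, v y * (1 / 2) ∂m ≤ ∫ y, v y * (α y).re ∂m := by
    refine integral_mono (hvint.mul_const _)
      ((v.continuous.mul hre).integrable_of_hasCompactSupport hvc.mul_right) fun y => ?_
    by_cases hy : v y = 0
    · simp [hy]
    · exact mul_le_mul_of_nonneg_left (hvU (subset_tsupport _ hy)).le (hv0 y)
  rw [integral_mul_const, h1] at h2
  linarith

theorem smear_character {m : Measure K} (hm : S.IsHaar m) {v : K → ℝ} (hv : Continuous v)
    (hvc : HasCompactSupport v) (hv0 : ∀ t, 0 ≤ v t) {α : K →ᵇ ℂ} (hα : S.IsCharacter α) :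
    hS.smear hm hv hvc (bcfToLpTop m α) = (∫ y, v y • α y ∂m) • α := by
  ext x
  have h1 : hS.smear hm hv hvc (bcfToLpTop m α) x = ∫ y, S.avg (S.inv x) v y • α y ∂m := by
    refine integral_congr_ae ?_
    filter_upwards [coeFn_bcfToLpTop (m := m) α] with y hy
    rw [hy]
  rw [h1, ← hS.integral_smul_avg hm x hv hvc hv0 α.continuous.aestronglyMeasurable
    (.of_forall α.norm_coe_le_norm)]
  change _ = (∫ y, v y • α y ∂m) * α x
  rw [← integral_mul_const]
  refine integral_congr_ae (.of_forall fun y => ?_)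
  change v y • (∫ t, α t ∂S.conv x y) = (v y • α y) * α x
  rw [hα.map_conv, smul_mul_assoc, mul_comm (α x)]

section Quotient

variable {H : Set K} (hH : S.IsSubgroup H ∨ (S.IsSubhypergroup H ∧ IsCompact H))

include hH

theorem eq_of_proj_eq_of_transl_eq (F : K →ᵇ ℂ) (hF : ∀ h ∈ H, hS.transl h F = F) {x y : K}
    (hxy : S.proj H x = S.proj H y) : F x = F y := by
  have key : ∀ L : ℂ →L[ℝ] ℝ, L (F x) = L (F y) := fun L => by
    refine hS.eq_of_proj_eq_of_avg_eq hH (BoundedContinuousFunction.comp L L.lipschitz F)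
      (fun h hh t => ?_) hxy
    have := hS.isProbability h t
    have h1 := L.integral_comp_comm (F.integrable (S.conv h t))
    have h2 : ∫ t, F t ∂S.conv h t = F t := DFunLike.congr_fun (hF h hh) t
    rw [h2] at h1
    exact h1
  exact Complex.ext (key Complex.reCLM) (key Complex.imCLM)

theorem isCharacter_pullback {γ : S.QuotSpace H →ᵇ ℂ} (hγ : (S.quot H).IsCharacter γ) :
    S.IsCharacter (S.pullback H γ) where
  ne_zero h := hγ.ne_zero <| by
    ext a
    rw [← S.proj_rep H a]
    exact DFunLike.congr_fun h (S.rep H a)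
  map_conv x y := (hS.integral_quot_conv hH x y γ.continuous.aestronglyMeasurable).symm.trans
    (hγ.map_conv _ _)
  map_inv x := by
    have h := hγ.map_inv (S.proj H x)
    rw [hS.quot_inv hH] at h
    exact h

variable {m : Measure K} (hm : S.IsHaar m)
    {m' : Measure (S.QuotSpace H)} (hm' : (S.quot H).IsHaar m')

include hm hm'

theorem quasiMeasurePreserving_proj : Measure.QuasiMeasurePreserving (S.proj H) m m' := by
  refine ⟨(S.continuous_proj H).measurable, Measure.AbsolutelyContinuous.mk fun N hN h0 => ?_⟩
  rw [Measure.map_apply (S.continuous_proj H).measurable hN]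
  exact hS.measure_preimage_proj_eq_zero hH hm hm' h0

theorem isAmenable_quot_of_isAmenable {γ : S.QuotSpace H →ᵇ ℂ}
    (h : S.IsAmenable m (S.pullback H γ)) : (S.quot H).IsAmenable m' γ := by
  obtain ⟨M, hM1, hM⟩ := h
  have hp := hS.quasiMeasurePreserving_proj hH hm hm'
  refine ⟨M.comp (compLpTop hp), ?_, fun a f g hg => ?_⟩
  · rw [← hM1]
    change M (MemLp.toLp _ (memLp_top_comp hp _)) = _
    congr 1
    exact MemLp.toLp_congr _ _ (hp.ae_eq_comp (memLp_top_of_bcf m' γ).coeFn_toLp)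
  · obtain ⟨x, rfl⟩ := (hS.isOpenQuotientMap_proj (isSubhypergroup_of_or hH)).surjective a
    refine hM x (compLpTop hp f) (compLpTop hp g) ?_
    have h1 := (coeFn_compLpTop hp g).trans (hp.ae_eq_comp hg)
    refine h1.trans (EventuallyEq.trans (.of_eq ?_)
      (hS.avg_congr_ae hm x (coeFn_compLpTop hp f)).symm)
    funext y
    exact hS.integral_quot_conv hH x y (Lp.stronglyMeasurable f).aestronglyMeasurable

omit hm hm' in
/-- The bounded continuous function on `K/H` that is induced by an `H`-invariant one on `K`. -/
theorem exists_bcf_comp_proj (F : K →ᵇ ℂ) (hF : ∀ h ∈ H, hS.transl h F = F) :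
    ∃ G : S.QuotSpace H →ᵇ ℂ, ∀ x, G (S.proj H x) = F x := by
  have hrep : ∀ x, F (S.rep H (S.proj H x)) = F x := fun x =>
    hS.eq_of_proj_eq_of_transl_eq hH F hF (S.proj_rep H _)
  refine ⟨BoundedContinuousFunction.ofNormedAddCommGroup (fun a => F (S.rep H a)) ?_ ‖F‖
    fun a => F.norm_coe_le_norm _, hrep⟩
  rw [← (hS.isOpenQuotientMap_proj (isSubhypergroup_of_or hH)).continuous_comp_iff]
  convert F.continuous using 1
  exact funext hrep

theorem isAmenable_of_isAmenable_quot {γ : S.QuotSpace H →ᵇ ℂ} (hγ : (S.quot H).IsCharacter γ)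
    (h : (S.quot H).IsAmenable m' γ) : S.IsAmenable m (S.pullback H γ) := by
  have hH' := isSubhypergroup_of_or hH
  have := hS.t2Space_quot hH'
  have := hS.locallyCompactSpace_quot hH'
  have hQ := hS.isCommHypergroup_quot hH
  have hsurj := (hS.isOpenQuotientMap_proj hH').surjective
  set α := S.pullback H γ with hαdef
  have hα : S.IsCharacter α := hS.isCharacter_pullback hH hγ
  have hα1 : ∀ h ∈ H, α h = 1 := fun h hh => by
    rw [← hα.map_one hS]
    exact congrArg γ ((hS.proj_eq_iff hH').2 (mem_coset_iff.2
      ⟨h, hh, by rw [hS.support_one_conv]; rfl⟩))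
  -- `T_h α = α(h) α = α` for `h ∈ H`, so `α` serves as the fixed vector.
  obtain ⟨μ, hμ1, hμ⟩ := exists_invariant_functional {T | ∃ h ∈ H, T = hS.transl h}
    (by rintro _ ⟨h, -, rfl⟩ _ ⟨k, -, rfl⟩; exact hS.transl_comm h k)
    (by rintro _ ⟨h, -, rfl⟩; exact hS.norm_transl_le h) hα.ne_zero
    (by rintro _ ⟨h, hh, rfl⟩; rw [hS.transl_character hα, hα1 h hh, one_smul])
  obtain ⟨v, hvc, hv0, hc⟩ := hS.exists_bump_integral_smul_ne_zero hm hα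
  set c := ∫ y, v y • α y ∂m
  set Φ := hS.smear hm v.continuous hvc
  have hΦ : ∀ f, Continuous fun x => hS.transl x (Φ f) :=
    hS.continuous_transl_smear hm v.continuous hvc
  have hbound : ∀ f x, ‖μ (hS.transl x (Φ f))‖ ≤ ‖μ‖ * (‖Φ‖ * ‖f‖) := fun f x => by
    refine (μ.le_opNorm _).trans ?_
    gcongr
    exact ((hS.transl x).le_of_opNorm_le (hS.norm_transl_le x) _).trans
      (by rw [one_mul]; exact Φ.le_opNorm f)
  -- Translating `x ↦ μ(T_x Φf)` by `h ∈ H` gives `μ(T_h T_x Φf)`, which is `μ(T_x Φf)` by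
  -- invariance; so the function descends to `K/H`.
  have hD : ∀ f, ∃ G : S.QuotSpace H →ᵇ ℂ, ∀ x, G (S.proj H x) = μ (hS.transl x (Φ f)) :=
    fun f => hS.exists_bcf_comp_proj hH
      (BoundedContinuousFunction.ofNormedAddCommGroup (fun x => μ (hS.transl x (Φ f)))
        (μ.continuous.comp (hΦ f)) _ (hbound f)) fun h hh => by
          ext x
          exact (hS.integral_functional_transl μ (hΦ f) h x).trans (hμ _ ⟨h, hh, rfl⟩ _)
  choose D hD using hD
  let DL : Lp ℂ ⊤ m →L[ℂ] (S.QuotSpace H →ᵇ ℂ) :=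
    LinearMap.mkContinuous
      { toFun := D
        map_add' := fun f g => by
          ext a
          obtain ⟨x, rfl⟩ := hsurj a
          simp only [BoundedContinuousFunction.add_apply, hD, map_add]
        map_smul' := fun k f => by
          ext a
          obtain ⟨x, rfl⟩ := hsurj a
          simp only [BoundedContinuousFunction.coe_smul, hD, map_smul, RingHom.id_apply] }
      (‖μ‖ * ‖Φ‖) fun f => by
        refine (BoundedContinuousFunction.norm_le (by positivity)).2 fun a => ?_
        obtain ⟨x, rfl⟩ := hsurj a
        change ‖D f (S.proj H x)‖ ≤ _
        rw [hD, mul_assoc]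
        exact hbound f x
  obtain ⟨M, hM1, hM⟩ := h
  refine ⟨c⁻¹ • M.comp ((bcfToLpTop m').comp DL), ?_, fun z f g hg => ?_⟩
  · have hDα : D (bcfToLpTop m α) = c • γ := by
      ext a
      obtain ⟨x, rfl⟩ := hsurj a
      rw [hD, hS.smear_character hm v.continuous hvc hv0 hα, map_smul, map_smul,
        hS.transl_character hα, map_smul, hμ1]
      simp only [smul_eq_mul, mul_one]
      rfl
    change c⁻¹ * M (bcfToLpTop m' (D (bcfToLpTop m α))) = 1
    rw [hDα, map_smul, map_smul, show M (bcfToLpTop m' γ) = 1 from hM1, smul_eq_mul, mul_one,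
      inv_mul_cancel₀ hc]
  -- At `xH` both sides equal `μ(T_z T_x Φf)`: the left because `Φg = T_z Φf` and translations
  -- commute, the right by passing `μ` through the integral over `ω(z, x)`.
  · have hDg : ⇑(D g) = (S.quot H).translate (S.proj H z) (D f) := by
      funext a
      obtain ⟨x, rfl⟩ := hsurj a
      rw [hD, show Φ g = _ from hS.smear_eq_transl hm v.continuous hvc hv0 z hg]
      have h1 := hS.integral_quot_conv hH z x (D f).continuous.aestronglyMeasurable
      rw [ConvData.translate, h1]
      simp only [hD]
      rw [hS.integral_functional_transl μ (hΦ f)]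
      exact congrArg μ (DFunLike.congr_fun (hS.transl_comm x z) _)
    have hae : bcfToLpTop m' (D g) =ᵐ[m']
        (S.quot H).translate (S.proj H z) (bcfToLpTop m' (D f)) :=
      (coeFn_bcfToLpTop (D g)).trans ((EventuallyEq.of_eq hDg).trans
        (hQ.avg_congr_ae hm' (S.proj H z) (coeFn_bcfToLpTop (m := m') (D f))).symm)
    have := hM (S.proj H z) _ _ hae
    change c⁻¹ * M (bcfToLpTop m' (D g)) = γ (S.proj H z) * (c⁻¹ * M (bcfToLpTop m' (D f)))
    rw [this]
    ring

end Quotient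

end IsCommHypergroup

end

theorem mainTheorem4 {K : Type*} [TopologicalSpace K] [T2Space K] [LocallyCompactSpace K]
    [MeasurableSpace K] [BorelSpace K] (S : ConvData K) (hS : IsCommHypergroup S)
    (H : Set K) (hH : S.IsSubgroup H ∨ (S.IsSubhypergroup H ∧ IsCompact H))
    (m : Measure K) (hm : S.IsHaar m)
    (m' : Measure (S.QuotSpace H)) (hm' : (S.quot H).IsHaar m')
    (γ : S.QuotSpace H →ᵇ ℂ) (hγ : (S.quot H).IsCharacter γ) :
    S.IsCharacter (S.pullback H γ) ∧
      ((S.quot H).IsAmenable m' γ ↔ S.IsAmenable m (S.pullback H γ)) :=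
  ⟨hS.isCharacter_pullback hH hγ, hS.isAmenable_of_isAmenable_quot hH hm hm' hγ,
    hS.isAmenable_quot_of_isAmenable hH hm hm'⟩
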